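/- Let $K$ be an imaginary-quadratic field with ring of integers $\mathfrak{o}$, discriminant $d_K\notin\{-3,-4\}$ and non-trivial automorphism $\overline{\phantom{x}}$. Let $(V,h)$ be a hermitian space of odd dimension $n$ over $K$ (not necessarily definite), with unitary group $U(V)$ and special unitary group $SU(V)=\{\sigma\in U(V)\mid\det\sigma=1\}$. A lattice on $V$ is a finitely generated $\mathfrak{o}$-submodule of $V$ that spans $V$ over $K$; it can be written as $\mathfrak{a}_1x_1+\dots+\mathfrak{a}_nx_n$ with a basis $x_1,\dots,x_n$ of $V$ and fractional ideals $\mathfrak{a}_i$, and its Steinitz class is $\mathfrak{st}(L)=[\mathfrak{a}_1\cdots\mathfrak{a}_n]$ in the ideal class group of $K$. For a prime number $p$ let $V_p=V\otimes_{\mathbb{Q}}\mathbb{Q}_p$ with the extended form, over $K_p=K\otimes_{\mathbb{Q}}\mathbb{Q}_p$, and let $L_p=L\otimes_{\mathbb{Z}}\mathbb{Z}_p\subseteq V_p$. The genus $\operatorname{gen}(L)$ (resp. special genus $\operatorname{gen}^+(L)$) is the set of lattices $N$ on $V$ such that for every prime $p$ there is $\sigma\in U(V_p)$ (resp. $\sigma\in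 SU(V_p)$) with $\sigma(L_p)=N_p$. Let $L$ be a unimodular lattice on $V$, i.e. $L=\{x\in V\mid h(x,L)\subseteq\mathfrak{o}\}$. Then the special class number of $L$, that is the number of $SU(V)$-orbits of lattices in $\operatorname{gen}^+(L)$, is equal to the partial class number of $L$, that is the number of isometry classes ($U(V)$-orbits) of lattices in the partial genus $\{N\in\operatorname{gen}(L)\mid\mathfrak{st}(N)=\mathfrak{st}(L)\}$. -/

import Mathlib

open Module NumberField TensorProduct
open scoped nonZeroDivisors

noncomputable section

namespace HermLat

section Sesquilinear

variable {R : Type*} [CommRing R] {τ : R →+* R} {M : Type*} [AddCommGroup M] [Module R M]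

/-- A sesquilinear form, linear in the first argument, is hermitian if
`h x y = τ (h y x)`. -/
def IsHermitian (h : M →ₗ[R] M →ₛₗ[τ] R) : Prop :=
  ∀ x y, h x y = τ (h y x)

/-- The unitary group of a space with a sesquilinear form. -/
def unitaryGroup (h : M →ₗ[R] M →ₛₗ[τ] R) : Subgroup (M ≃ₗ[R] M) where
  carrier := {σ | ∀ x y, h (σ x) (σ y) = h x y}
  mul_mem' := by
    intro a b ha hb x y
    simp only [Set.mem_ofPred_eq] at ha hb
    rw [LinearEquiv.mul_apply, LinearEquiv.mul_apply, ha, hb]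
  one_mem' := fun _ _ => rfl
  inv_mem' := by
    intro a ha x y
    have h1 := ha (a⁻¹ x) (a⁻¹ y)
    rw [← LinearEquiv.mul_apply, ← LinearEquiv.mul_apply, mul_inv_cancel] at h1
    exact h1.symm

/-- The special unitary group: the isometries of determinant `1`. -/
def specialUnitaryGroup (h : M →ₗ[R] M →ₛₗ[τ] R) : Subgroup (M ≃ₗ[R] M) :=
  unitaryGroup h ⊓ (LinearEquiv.det : (M ≃ₗ[R] M) →* Rˣ).ker

end Sesquilinear

section BaseChange

variable {R : Type*} [CommRing R] {τ : R →+* R} {M : Type*} [AddCommGroup M] [Module R M]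
  {A : Type*} [CommRing A] [Algebra R A]

/-- The first step of the extension of scalars: for fixed `y`, the `A`-linear form
`a ⊗ x ↦ a * h x y` on `A ⊗ M`. -/
def extendLeft (h : M →ₗ[R] M →ₛₗ[τ] R) (y : M) : A ⊗[R] M →ₗ[A] A :=
  AlgebraTensorModule.lift
    { toFun := fun a => a • (Algebra.linearMap R A).comp (h.flip y)
      map_add' := fun a b => add_smul a b _
      map_smul' := fun a b => by simp [mul_smul] }

theorem extendLeft_tmul (h : M →ₗ[R] M →ₛₗ[τ] R) (y : M) (a : A) (x : M) :
    extendLeft h y (a ⊗ₜ[R] x) = a * algebraMap R A (h x y) := by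
  simp [extendLeft]

/-- The additive map `b ⊗ y ↦ (a ⊗ x ↦ a * τA b * h x y)`. -/
def extendAux (h : M →ₗ[R] M →ₛₗ[τ] R) (τA : A →+* A)
    (hτ : ∀ r, τA (algebraMap R A r) = algebraMap R A (τ r)) :
    A ⊗[R] M →+ (A ⊗[R] M →ₗ[A] A) :=
  TensorProduct.liftAddHom
    { toFun := fun b =>
        { toFun := fun y => τA b • extendLeft h y
          map_zero' := by
            ext x
            simp [extendLeft_tmul]
          map_add' := fun y z => by
            ext x
            simp [extendLeft_tmul, mul_add] }
      map_zero' := by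
        ext y x
        simp
      map_add' := fun b c => by
        ext y x
        simp [add_mul] }
    (fun r b y => by
      ext x
      simp [extendLeft_tmul, Algebra.smul_def, hτ]
      ring)

theorem extendAux_tmul (h : M →ₗ[R] M →ₛₗ[τ] R) (τA : A →+* A)
    (hτ : ∀ r, τA (algebraMap R A r) = algebraMap R A (τ r)) (b : A) (y : M) :
    extendAux h τA hτ (b ⊗ₜ[R] y) = τA b • extendLeft h y := rfl

/-- The extension of a sesquilinear form `h` on `M` to `A ⊗ M`, where `τA` is a ring
endomorphism of `A` that extends `τ`. It is determined by `extendForm_tmul`. -/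
def extendForm (h : M →ₗ[R] M →ₛₗ[τ] R) (τA : A →+* A)
    (hτ : ∀ r, τA (algebraMap R A r) = algebraMap R A (τ r)) :
    A ⊗[R] M →ₗ[A] A ⊗[R] M →ₛₗ[τA] A :=
  LinearMap.mk₂'ₛₗ (RingHom.id A) τA (fun u v => extendAux h τA hτ v u)
    (fun u u' v => map_add _ u u')
    (fun c u v => map_smul _ c u)
    (fun u v v' => by simp)
    (fun c u v => by
      induction v with
      | zero => simp
      | add v w hv hw => simpa [smul_add, mul_add] using congrArg₂ (· + ·) hv hw
      | tmul b y =>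
        rw [TensorProduct.smul_tmul', extendAux_tmul, extendAux_tmul]
        simp [mul_assoc])

theorem extendForm_tmul (h : M →ₗ[R] M →ₛₗ[τ] R) (τA : A →+* A)
    (hτ : ∀ r, τA (algebraMap R A r) = algebraMap R A (τ r)) (a b : A) (x y : M) :
    extendForm h τA hτ (a ⊗ₜ[R] x) (b ⊗ₜ[R] y) = a * τA b * algebraMap R A (h x y) := by
  change extendAux h τA hτ (b ⊗ₜ[R] y) (a ⊗ₜ[R] x) = _
  rw [extendAux_tmul, LinearMap.smul_apply, extendLeft_tmul, smul_eq_mul]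
  ring

end BaseChange

section Local

variable (K : Type*) [Field K] [NumberField K] (p : ℕ) [Fact p.Prime]

/-- The local algebra `K_p = K ⊗ ℚ_p` at a rational prime `p`. -/
abbrev LocalAlg : Type _ := K ⊗[ℚ] ℚ_[p]

/-- The local ring `𝔬_p`: the image of `𝓞 K ⊗ ℤ_p` in `K ⊗ ℚ_p`. -/
def localInt : Subalgebra ℤ (LocalAlg K p) :=
  (Algebra.TensorProduct.productMap
    (((Algebra.TensorProduct.includeLeft : K →ₐ[ℚ] LocalAlg K p).toRingHom.comp
      (algebraMap (𝓞 K) K)).toIntAlgHom)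
    (((Algebra.TensorProduct.includeRight : ℚ_[p] →ₐ[ℚ] LocalAlg K p).toRingHom.comp
      (algebraMap ℤ_[p] ℚ_[p])).toIntAlgHom)).range

variable {K}

/-- The extension of the conjugation of `K` to `K ⊗ ℚ_p`. -/
def localConj (conj : K ≃ₐ[ℚ] K) : LocalAlg K p →+* LocalAlg K p :=
  (Algebra.TensorProduct.map (conj : K →ₐ[ℚ] K) (AlgHom.id ℚ ℚ_[p])).toRingHom

theorem localConj_algebraMap (conj : K ≃ₐ[ℚ] K) (r : K) :
    localConj p conj (algebraMap K (LocalAlg K p) r) =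
      algebraMap K (LocalAlg K p) ((conj : K →+* K) r) := by
  simp [localConj, Algebra.TensorProduct.algebraMap_apply]

end Local

section Lattices

variable {K : Type*} [Field K] [NumberField K] {conj : K ≃ₐ[ℚ] K}
  {V : Type*} [AddCommGroup V] [Module K V] [Module (𝓞 K) V] [IsScalarTower (𝓞 K) K V]

/-- The localization `V_p` of `V`, written as `K_p ⊗_K V = V ⊗_ℚ ℚ_p`. -/
abbrev LocalSpace (K : Type*) [Field K] [NumberField K] (p : ℕ) [Fact p.Prime]
    (V : Type*) [AddCommGroup V] [Module K V] : Type _ :=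
  LocalAlg K p ⊗[K] V

/-- The `p`-adic extension of the form `h` to `V_p`. -/
def localForm (h : V →ₗ[K] V →ₛₗ[(conj : K →+* K)] K) (p : ℕ) [Fact p.Prime] :
    LocalSpace K p V →ₗ[LocalAlg K p] LocalSpace K p V →ₛₗ[localConj p conj] LocalAlg K p :=
  extendForm h (localConj p conj) (localConj_algebraMap p conj)

/-- The localization `L_p` of a lattice: the `𝔬_p`-submodule of `V_p` generated by `L`. -/
def localLattice (L : Submodule (𝓞 K) V) (p : ℕ) [Fact p.Prime] :
    Submodule (localInt K p) (LocalSpace K p V) :=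
  Submodule.span (localInt K p) ((fun x : V => (1 : LocalAlg K p) ⊗ₜ[K] x) '' (L : Set V))

/-- The dual `{x | h(x, L) ⊆ 𝓞 K}` of `L`. -/
def dual (h : V →ₗ[K] V →ₛₗ[(conj : K →+* K)] K) (L : Submodule (𝓞 K) V) :
    Submodule (𝓞 K) V where
  carrier := {x | ∀ y ∈ L, ∃ a : 𝓞 K, algebraMap (𝓞 K) K a = h x y}
  zero_mem' := fun y _ => ⟨0, by simp⟩
  add_mem' := by
    intro x x' hx hx' y hy
    obtain ⟨a, ha⟩ := hx y hy
    obtain ⟨b, hb⟩ := hx' y hy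
    exact ⟨a + b, by rw [map_add, map_add, LinearMap.add_apply, ha, hb]⟩
  smul_mem' := by
    intro c x hx y hy
    obtain ⟨a, ha⟩ := hx y hy
    refine ⟨c * a, ?_⟩
    rw [map_mul, ha, ← algebraMap_smul K c x, map_smul, LinearMap.smul_apply, smul_eq_mul]

/-- `L` is a lattice on `V` that equals its dual. -/
def IsUnimodular (h : V →ₗ[K] V →ₛₗ[(conj : K →+* K)] K) (L : Submodule (𝓞 K) V) : Prop :=
  L.IsLattice K ∧ dual h L = L

/-- The isometry class of `L`: its images under `U(V)`. -/
def cls (h : V →ₗ[K] V →ₛₗ[(conj : K →+* K)] K) (L : Submodule (𝓞 K) V) :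
    Set (Submodule (𝓞 K) V) :=
  {N | ∃ σ ∈ unitaryGroup h, (N : Set V) = σ '' (L : Set V)}

/-- The special class of `L`: its images under `SU(V)`. -/
def specialCls (h : V →ₗ[K] V →ₛₗ[(conj : K →+* K)] K) (L : Submodule (𝓞 K) V) :
    Set (Submodule (𝓞 K) V) :=
  {N | ∃ σ ∈ specialUnitaryGroup h, (N : Set V) = σ '' (L : Set V)}

/-- The genus of `L`: the lattices on `V` that are isometric to `L` at all primes. -/
def genus (h : V →ₗ[K] V →ₛₗ[(conj : K →+* K)] K) (L : Submodule (𝓞 K) V) :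
    Set (Submodule (𝓞 K) V) :=
  {N | N.IsLattice K ∧ ∀ (p : ℕ) [Fact p.Prime], ∃ σ ∈ unitaryGroup (localForm h p),
    (localLattice N p : Set (LocalSpace K p V)) = σ '' (localLattice L p : Set _)}

/-- The special genus of `L`: as the genus, with local isometries of determinant `1`. -/
def specialGenus (h : V →ₗ[K] V →ₛₗ[(conj : K →+* K)] K) (L : Submodule (𝓞 K) V) :
    Set (Submodule (𝓞 K) V) :=
  {N | N.IsLattice K ∧ ∀ (p : ℕ) [Fact p.Prime], ∃ σ ∈ specialUnitaryGroup (localForm h p),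
    (localLattice N p : Set (LocalSpace K p V)) = σ '' (localLattice L p : Set _)}

/-- `L = 𝔞₁ x₁ + ⋯ + 𝔞ₙ xₙ` for a basis `x` of `V` and fractional ideals `𝔞ᵢ` whose
product has the class `c`. -/
def HasSteinitzClass (L : Submodule (𝓞 K) V) (c : ClassGroup (𝓞 K)) : Prop :=
  ∃ (x : Basis (Fin (finrank K V)) K V)
    (a : Fin (finrank K V) → (FractionalIdeal (𝓞 K)⁰ K)ˣ),
    (∀ v, v ∈ L ↔ ∀ i, x.repr v i ∈ (a i : FractionalIdeal (𝓞 K)⁰ K)) ∧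
      ClassGroup.mk K (∏ i, a i) = c

/-- The Steinitz class of a lattice on `V`: the class `c` with `HasSteinitzClass L c`
(it exists and is unique for a lattice `L` on `V`). -/
def steinitzClass (L : Submodule (𝓞 K) V) : ClassGroup (𝓞 K) :=
  Classical.epsilon (HasSteinitzClass L)

/-- The partial genus: the lattices in the genus of `L` with Steinitz class `c`. -/
def partialGenus (h : V →ₗ[K] V →ₛₗ[(conj : K →+* K)] K) (L : Submodule (𝓞 K) V)
    (c : ClassGroup (𝓞 K)) : Set (Submodule (𝓞 K) V) :=
  {N | N ∈ genus h L ∧ steinitzClass N = c}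

/-- The number of isometry classes of lattices in the partial genus, as a cardinal. -/
def partialClassNumber (h : V →ₗ[K] V →ₛₗ[(conj : K →+* K)] K) (L : Submodule (𝓞 K) V)
    (c : ClassGroup (𝓞 K)) : Cardinal :=
  Cardinal.mk (cls h '' partialGenus h L c)

/-- The number of special classes of lattices in the special genus, as a cardinal. -/
def specialClassNumber (h : V →ₗ[K] V →ₛₗ[(conj : K →+* K)] K) (L : Submodule (𝓞 K) V) :
    Cardinal :=
  Cardinal.mk (specialCls h '' specialGenus h L)

end Lattices

end HermLat

end

/-
A lattice in the special genus of `L` has the same determinant ideal as `L`, hence the same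
Steinitz class. Conversely, for `N` in the partial genus the two determinant ideals differ by a
factor `d` whose norm is a local unit everywhere and positive, hence `1`. Since the rank is odd, `L`
contains, for every prime `p`, a vector whose norm is prime to `p`. A global quasi-reflection of
determinant `d⁻¹`, followed by local quasi-reflections along such vectors, which preserve `L_p`,
brings `N` into the special genus. Finally, an isometry between lattices of the special genus has a
root of unity as its determinant; scaling by a root of unity makes it `1`, because the rank is
coprime to the number of roots of unity in `K`.
-/

noncomputable section

namespace HermLat

open scoped Matrix Pointwise

section ImaginaryQuadratic

variable {K : Type*} [Field K] [NumberField K]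

theorem natDegree_minpoly_eq_totient {n : ℕ} [NeZero n] {ζ : K} (hζ : IsPrimitiveRoot ζ n) :
    (minpoly ℚ ζ).natDegree = n.totient := by
  rw [← hζ.minpoly_eq_cyclotomic_of_irreducible
    (Polynomial.cyclotomic.irreducible_rat (NeZero.pos n)), Polynomial.natDegree_cyclotomic]

theorem isCyclotomicExtension_of_totient_eq_finrank {n : ℕ} [NeZero n] {ζ : K}
    (hζ : IsPrimitiveRoot ζ n) (hn : n.totient = finrank ℚ K) :
    IsCyclotomicExtension {n} ℚ K := by
  have htop : IntermediateField.adjoin ℚ {ζ} = ⊤ :=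
    (Field.primitive_element_iff_minpoly_natDegree_eq ℚ ζ).mpr
      ((natDegree_minpoly_eq_totient hζ).trans hn)
  have hcyc := hζ.intermediateField_adjoin_isCyclotomicExtension ℚ
  rw [htop] at hcyc
  exact hcyc.equiv {n} ℚ _ IntermediateField.topEquiv

theorem exists_isPrimitiveRoot_of_dvd_torsionOrder {n : ℕ} (hn : n ∣ Units.torsionOrder K) :
    ∃ ζ : K, IsPrimitiveRoot ζ n := by
  obtain ⟨u, hu⟩ : ∃ u : Units.torsion K, orderOf u = Units.torsionOrder K :=
    IsCyclic.exists_ofOrder_eq_natCard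
  rw [← IsPrimitiveRoot.iff_orderOf, ← IsPrimitiveRoot.coe_submonoidClass_iff,
    ← IsPrimitiveRoot.coe_units_iff] at hu
  obtain ⟨m, hm⟩ := hn
  exact ⟨_, (hu.map_of_injective (FaithfulSMul.algebraMap_injective (𝓞 K) K)).pow
    (Units.torsionOrder_pos K) (hm.trans (mul_comm n m))⟩

variable [Algebra.IsQuadraticExtension ℚ K]

theorem torsionOrder_eq_two (hd₃ : discr K ≠ -3) (hd₄ : discr K ≠ -4) :
    Units.torsionOrder K = 2 := by
  have hK : finrank ℚ K = 2 := Algebra.IsQuadraticExtension.finrank_eq_two ℚ K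
  have h_four : ¬ 2 ^ 2 ∣ Units.torsionOrder K := fun hdvd => by
    obtain ⟨ζ, hζ⟩ := exists_isPrimitiveRoot_of_dvd_torsionOrder hdvd
    have := isCyclotomicExtension_of_totient_eq_finrank hζ (by rw [hK]; decide)
    exact hd₄ (by simpa using IsCyclotomicExtension.Rat.discr_prime_pow_succ 2 1 K)
  have h_odd : ∀ p : ℕ, p.Prime → p ∣ Units.torsionOrder K → p = 2 := by
    intro p hp hdvd
    have : Fact p.Prime := ⟨hp⟩
    obtain ⟨ζ, hζ⟩ := exists_isPrimitiveRoot_of_dvd_torsionOrder hdvd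
    have htot := minpoly.degree_dvd (IsIntegral.of_finite ℚ ζ)
    rw [natDegree_minpoly_eq_totient hζ, hK, Nat.totient_prime hp,
      Nat.dvd_prime Nat.prime_two] at htot
    by_contra hp2
    obtain rfl : p = 3 := by omega
    have := isCyclotomicExtension_of_totient_eq_finrank hζ (by rw [hK]; decide)
    exact hd₃ (by simpa using IsCyclotomicExtension.Rat.discr_prime 3 K)
  obtain ⟨m, hm⟩ := Units.even_torsionOrder K |>.two_dvd
  suffices m = 1 by omega
  by_contra hm1
  obtain ⟨q, hq, hqm⟩ := Nat.exists_prime_and_dvd hm1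
  obtain rfl := h_odd q hq (hm ▸ hqm.mul_left 2)
  exact h_four (hm ▸ by rw [pow_two]; exact mul_dvd_mul_left 2 hqm)

variable (K) in
theorem existsUnique_gal_ne_one : ∃! σ : K ≃ₐ[ℚ] K, σ ≠ 1 := by
  rw [← Nat.card_eq_two_iff' 1, IsGalois.card_aut_eq_finrank,
    Algebra.IsQuadraticExtension.finrank_eq_two]

variable {conj : K ≃ₐ[ℚ] K}

theorem conj_conj (hconj : conj ≠ 1) (x : K) : conj (conj x) = x := by
  have hsq : conj * conj = 1 := by
    by_contra hne
    refine hconj (mul_eq_left.mp ((existsUnique_gal_ne_one K).unique hne hconj))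
  exact DFunLike.congr_fun hsq x

theorem exists_intCast_eq_of_conj_eq (hconj : conj ≠ 1) {a : 𝓞 K} (ha : conj a = (a : K)) :
    ∃ m : ℤ, (m : 𝓞 K) = a := by
  have hmem : (a : K) ∈ (⊥ : IntermediateField ℚ K) := by
    rw [IsGalois.mem_bot_iff_fixed]
    intro f
    by_cases hf : f = 1
    · rw [hf]; rfl
    · rw [(existsUnique_gal_ne_one K).unique hf hconj, ha]
  obtain ⟨q, hq⟩ := IntermediateField.mem_bot.mp hmem
  have hqint : IsIntegral ℤ q := by
    rw [← isIntegral_algebraMap_iff (algebraMap ℚ K).injective, hq]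
    exact a.isIntegral_coe
  obtain ⟨m, rfl⟩ := IsIntegrallyClosed.isIntegral_iff.mp hqint
  exact ⟨m, RingOfIntegers.ext (by rw [← hq]; simp)⟩

variable [IsTotallyComplex K]

theorem embedding_conj (hconj : conj ≠ 1) (φ : K →+* ℂ) (x : K) : φ (conj x) = star (φ x) := by
  obtain ⟨σ, hσ⟩ := InfinitePlace.exists_isConj_of_isRamified (k := ℚ) (φ := φ)
    (InfinitePlace.isRamified_iff.mpr ⟨IsTotallyComplex.isComplex _, IsTotallyReal.isReal _⟩)
  have hσ_ne : σ ≠ 1 := (ComplexEmbedding.isConj_ne_one_iff hσ).mpr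
    (IsTotallyComplex.complexEmbedding_not_isReal φ)
  rw [(existsUnique_gal_ne_one K).unique hconj hσ_ne, hσ.eq]

theorem mul_conj_eq_one_of_eq_unit (hconj : conj ≠ 1) {d : K} {u : (𝓞 K)ˣ}
    (hu : (u : K) = d * conj d) : d * conj d = 1 := by
  obtain ⟨φ⟩ : Nonempty (K →+* ℂ) := inferInstance
  obtain ⟨m, hm⟩ : ∃ m : ℤ, (m : 𝓞 K) = u := exists_intCast_eq_of_conj_eq hconj (by
    change conj (algebraMap (𝓞 K) K u) = algebraMap (𝓞 K) K u
    rw [hu, map_mul, conj_conj hconj, mul_comm])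
  have hmd : (m : K) = d * conj d := by rw [← hu, ← hm]; simp
  have hnorm : ((m : ℝ) : ℂ) = (Complex.normSq (φ d) : ℝ) := by
    rw [Complex.normSq_eq_conj_mul_self, mul_comm, Complex.ofReal_intCast]
    change _ = φ d * star (φ d)
    rw [← embedding_conj hconj, ← map_mul, ← hmd, map_intCast]
  have hm_nonneg : 0 ≤ m := by
    exact_mod_cast (Complex.ofReal_injective hnorm).symm ▸ Complex.normSq_nonneg (φ d)
  have hm_unit : IsUnit m := by
    rw [← isUnit_map_iff (algebraMap ℤ (𝓞 K))]
    simp [hm]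
  rw [← hmd, Int.isUnit_iff.mp hm_unit |>.resolve_right (by omega), Int.cast_one]

theorem unit_mul_conj_eq_one (hconj : conj ≠ 1) (u : (𝓞 K)ˣ) :
    (u : K) * conj (u : K) = 1 := by
  have hconj_unit : IsUnit (RingOfIntegers.mapRingEquiv (conj : K ≃+* K) (u : 𝓞 K)) :=
    u.isUnit.map _
  exact mul_conj_eq_one_of_eq_unit hconj (u := u * hconj_unit.unit) (by simp)

variable (K) in
theorem torsion_units_eq_top : Units.torsion K = ⊤ := by
  obtain ⟨conj, hconj, -⟩ := existsUnique_gal_ne_one K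
  refine (Subgroup.eq_top_iff' _).mpr fun u => (Units.mem_torsion K).mpr fun w => ?_
  have hw : w (conj (u : K)) = w (u : K) := by
    rw [← InfinitePlace.norm_embedding_eq, embedding_conj hconj, norm_star,
      InfinitePlace.norm_embedding_eq]
  have hsq := congrArg w (unit_mul_conj_eq_one hconj u)
  rw [map_mul, hw, map_one, ← pow_two] at hsq
  exact (pow_eq_one_iff_of_nonneg (apply_nonneg w _) two_ne_zero).mp hsq

theorem exists_unit_pow_eq {n : ℕ} (hn : n.Coprime (Units.torsionOrder K)) (u : (𝓞 K)ˣ) :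
    ∃ ζ : (𝓞 K)ˣ, ζ ^ n = u := by
  have hu : u ∈ Units.torsion K := torsion_units_eq_top K ▸ Subgroup.mem_top u
  obtain ⟨ζ, hζ⟩ := (powCoprime (G := Units.torsion K) hn.symm).surjective ⟨u, hu⟩
  exact ⟨ζ, congrArg Subtype.val hζ⟩

end ImaginaryQuadratic

theorem prod_apply_inv_eq {ι R : Type*} [Fintype ι] [CommRing R] {τ : R →+* R}
    {A : Matrix ι ι R} (hA : ∀ i j, A j i = τ (A i j)) (σ : Equiv.Perm ι) :
    ∏ i, A (σ⁻¹ i) i = τ (∏ i, A (σ i) i) := by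
  rw [map_prod, ← Equiv.prod_comp σ]
  exact Finset.prod_congr rfl fun i _ => by
    rw [← Equiv.Perm.mul_apply, inv_mul_cancel, Equiv.Perm.one_apply, hA]

-- The terms of the Leibniz formula at `σ` and `σ⁻¹` are interchanged by `τ`, and an involution of
-- a set of odd size has a fixed point.
theorem det_mem_of_odd_card {ι R : Type*} [Fintype ι] [DecidableEq ι] [CommRing R]
    {τ : R →+* R} {I : Ideal R} {A : Matrix ι ι R} (hι : Odd (Fintype.card ι))
    (hA : ∀ i j, A j i = τ (A i j)) (hdiag : ∀ i, A i i ∈ I)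
    (htrace : ∀ r i j, r * A i j + τ (r * A i j) ∈ I) : A.det ∈ I := by
  rw [← Ideal.Quotient.eq_zero_iff_mem, Matrix.det_apply', map_sum]
  refine Finset.sum_involution (fun σ _ => σ⁻¹) (fun σ _ => ?_) (fun σ _ hne hσ => hne ?_)
    (fun _ _ => Finset.mem_univ _) (fun σ _ => inv_inv σ)
  · obtain ⟨i⟩ : Nonempty ι := Fintype.card_pos_iff.mp hι.pos
    have hterm := htrace ((Equiv.Perm.sign σ : ℤ) * ∏ j ∈ Finset.univ.erase i, A (σ j) j) (σ i) i
    rw [mul_assoc, Finset.prod_erase_mul _ _ (Finset.mem_univ i), map_mul, map_intCast,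
      ← prod_apply_inv_eq hA] at hterm
    rwa [← map_add, Equiv.Perm.sign_inv, Ideal.Quotient.eq_zero_iff_mem]
  · have hσ₂ : σ ^ 2 ^ 1 = 1 := by rw [pow_one, pow_two, mul_eq_one_iff_inv_eq, hσ]
    have : Fact (Nat.Prime 2) := ⟨Nat.prime_two⟩
    obtain ⟨i, hi⟩ := Equiv.Perm.exists_fixed_point_of_prime hι.not_two_dvd_nat hσ₂
    refine Ideal.Quotient.eq_zero_iff_mem.mpr (I.mul_mem_left _ ?_)
    rw [← Finset.prod_erase_mul _ _ (Finset.mem_univ i), hi]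
    exact I.mul_mem_left _ (hdiag i)

section QuasiReflection

variable {R : Type*} [CommRing R] {τ : R →+* R} {M : Type*} [AddCommGroup M] [Module R M]
  {h : M →ₗ[R] M →ₛₗ[τ] R} {x : M} {c : R} {u : Rˣ}

theorem one_add_smul_flip_apply (hc : c * h x x = 1) :
    1 + (((u - 1 : R) * c) • h.flip x) x = u := by
  rw [LinearMap.smul_apply, LinearMap.flip_apply, smul_eq_mul, mul_assoc, hc]
  ring

/-- The quasi-reflection that multiplies an anisotropic vector `x` by the unit `u` and fixes the
vectors `v` with `h v x = 0`; here `c` is the inverse of `h x x`. -/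
def quasiReflection (h : M →ₗ[R] M →ₛₗ[τ] R) (hc : c * h x x = 1) (u : Rˣ) : M ≃ₗ[R] M :=
  LinearEquiv.dilatransvection (f := ((u - 1 : R) * c) • h.flip x)
    ((one_add_smul_flip_apply hc).symm ▸ u.isUnit)

theorem quasiReflection_apply (hc : c * h x x = 1) (v : M) :
    quasiReflection h hc u v = v + ((u - 1 : R) * c * h v x) • x :=
  LinearEquiv.dilatransvection.apply

theorem quasiReflection_symm_apply (hc : c * h x x = 1) (v : M) :
    (quasiReflection h hc u).symm v = v + ((↑u⁻¹ - 1 : R) * c * h v x) • x := by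
  rw [LinearEquiv.symm_apply_eq, quasiReflection_apply, map_add, map_smul, LinearMap.add_apply,
    LinearMap.smul_apply, smul_eq_mul, add_assoc, ← add_smul, left_eq_add]
  convert zero_smul R x using 2
  linear_combination (c * h v x) * u.mul_inv + ((u - 1 : R) * (↑u⁻¹ - 1) * c * h v x) * hc

theorem det_quasiReflection [Module.Free R M] [Module.Finite R M] (hc : c * h x x = 1) :
    LinearEquiv.det (quasiReflection h hc u) = u := by
  ext
  rw [LinearEquiv.coe_det]
  change LinearMap.det (LinearMap.transvection (((u - 1 : R) * c) • h.flip x) x) = u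
  rw [LinearMap.transvection.det, one_add_smul_flip_apply hc]

theorem quasiReflection_mem_unitaryGroup (hx : ∀ w, h x w = τ (h w x)) (hc : c * h x x = 1)
    (hu : (u : R) * τ u = 1) : quasiReflection h hc u ∈ unitaryGroup h := by
  have hcτ : τ c * h x x = 1 := by
    have := congrArg τ hc
    rwa [map_mul, ← hx, map_one] at this
  have hcc : τ c = c := by linear_combination c * hcτ - τ c * hc
  intro v w
  simp only [quasiReflection_apply, map_add, LinearMap.add_apply, map_smul, LinearMap.smul_apply,
    map_smulₛₗ, smul_eq_mul, map_mul, map_sub, map_one, hcc, hx w]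
  linear_combination (h v x * τ (h w x) * c) * hu +
    ((u - 1 : R) * (τ u - 1) * c * h v x * τ (h w x)) * hc

end QuasiReflection

section PseudoBasis

theorem repr_mkFinCons_smul_add {R M : Type*} [CommRing R] [AddCommGroup M] [Module R M] {n : ℕ}
    {N : Submodule R M} {e : M} (y : Basis (Fin n) R N)
    (hli : ∀ c : R, ∀ w ∈ N, c • e + w = 0 → c = 0) (hsp : ∀ v : M, ∃ c : R, v + c • e ∈ N)
    (c : R) (w : N) :
    ⇑((Basis.mkFinCons e y hli hsp).repr (c • e + w)) = Fin.cons c (y.repr w) := by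
  have hsum : c • e + w = ∑ i, (Fin.cons c (y.repr w) : Fin (n + 1) → R) i •
      Basis.mkFinCons e y hli hsp i := by
    have hw : (w : M) = ∑ i, y.repr w i • (y i : M) := by
      conv_lhs => rw [← y.sum_repr w, Submodule.coe_sum]
      rfl
    simpa [Fin.sum_univ_succ] using hw
  rw [hsum, Basis.repr_sum_self]

universe u

variable {R K : Type*} [CommRing R] [Field K] [Algebra R K]
  {V : Type*} [AddCommGroup V] [Module K V] [Module R V]

/-- `L = 𝔞₁ x₁ + ⋯ + 𝔞ₙ xₙ` for the basis `x` of `V` and the fractional ideals `𝔞ᵢ`, expressed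
through the coordinates of the vectors of `L`. -/
def IsPseudoBasis {ι : Type*} (x : Basis ι K V) (a : ι → (FractionalIdeal R⁰ K)ˣ)
    (L : Submodule R V) : Prop :=
  ∀ v, v ∈ L ↔ ∀ i, x.repr v i ∈ (a i : FractionalIdeal R⁰ K)

variable [IsScalarTower R K V] {L : Submodule R V} {f : V →ₗ[K] K}
  {a : (FractionalIdeal R⁰ K)ˣ}

theorem isPseudoBasis_mkFinCons {n : ℕ}
    (ha : ((a : FractionalIdeal R⁰ K) : Submodule R K) = L.map (f.restrictScalars R)) {e : V}
    (he : f e = 1) (hae : ∀ c ∈ (a : FractionalIdeal R⁰ K), c • e ∈ L)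
    {y : Basis (Fin n) K (LinearMap.ker f)} {b : Fin n → (FractionalIdeal R⁰ K)ˣ}
    (hy : IsPseudoBasis y b (L.comap ((LinearMap.ker f).subtype.restrictScalars R)))
    (hli : ∀ c : K, ∀ w ∈ LinearMap.ker f, c • e + w = 0 → c = 0)
    (hsp : ∀ v : V, ∃ c : K, v + c • e ∈ LinearMap.ker f) :
    IsPseudoBasis (Basis.mkFinCons e y hli hsp) (Fin.cons a b) L := by
  intro v
  let w : LinearMap.ker f := ⟨v - f v • e, by simp [he]⟩
  have hv : v = f v • e + w := (add_sub_cancel _ _).symm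
  have hw : v - f v • e ∈ L ↔ ∀ i, y.repr w i ∈ (b i : FractionalIdeal R⁰ K) := hy w
  have hrepr : ⇑((Basis.mkFinCons e y hli hsp).repr v) = Fin.cons (f v) (y.repr w) := by
    conv_lhs => rw [hv]
    exact repr_mkFinCons_smul_add y hli hsp (f v) w
  simp only [hrepr, Fin.forall_fin_succ, Fin.cons_zero, Fin.cons_succ]
  rw [← hw]
  constructor
  · intro hvL
    have hfv : f v ∈ ((a : FractionalIdeal R⁰ K) : Submodule R K) := ha ▸ ⟨v, hvL, rfl⟩
    exact ⟨hfv, L.sub_mem hvL (hae _ hfv)⟩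
  · rintro ⟨hfv, hwL⟩
    rw [← sub_add_cancel v (f v • e)]
    exact L.add_mem hwL (hae _ hfv)

variable [IsFractionRing R K]

theorem exists_smul_mem (hL : L.IsLattice K) (v : V) : ∃ s ∈ R⁰, s • v ∈ L := by
  obtain ⟨s, hs⟩ := multiple_mem_span_of_mem_localization_span R⁰ K (L : Set V) v
    (hL.span_eq_top ▸ Submodule.mem_top)
  rw [Submodule.span_eq] at hs
  exact ⟨s, s.2, hs⟩

theorem isLattice_comap_subtype [IsNoetherianRing R] (hL : L.IsLattice K) (W : Submodule K V) :
    (L.comap (W.subtype.restrictScalars R)).IsLattice K := by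
  refine ⟨Submodule.fg_of_fg_map_injective (W.subtype.restrictScalars R) Subtype.val_injective
    (hL.fg.of_le (Submodule.map_comap_le _ _)), eq_top_iff.mpr fun w _ => ?_⟩
  obtain ⟨s, hs, hsw⟩ := exists_smul_mem hL (w : V)
  rw [← inv_smul_smul₀ (IsLocalization.map_units K (⟨s, hs⟩ : R⁰)).ne_zero w, algebraMap_smul]
  exact Submodule.smul_mem _ _ (Submodule.subset_span hsw)

variable [IsDedekindDomain R]

theorem exists_fractionalIdeal_eq_map (hL : L.IsLattice K) (hf : f ≠ 0) :
    ∃ a : (FractionalIdeal R⁰ K)ˣ,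
      ((a : FractionalIdeal R⁰ K) : Submodule R K) = L.map (f.restrictScalars R) := by
  let I : FractionalIdeal R⁰ K := ⟨L.map (f.restrictScalars R),
    FractionalIdeal.isFractional_of_fg (hL.fg.map _)⟩
  have hI : I ≠ 0 := by
    obtain ⟨v, hv⟩ := DFunLike.ne_iff.mp hf
    obtain ⟨s, hs, hsv⟩ := exists_smul_mem hL v
    intro h0
    have hmem : f (s • v) ∈ I := ⟨_, hsv, rfl⟩
    rw [h0, FractionalIdeal.mem_zero_iff, ← algebraMap_smul K s, map_smul] at hmem
    exact smul_ne_zero (IsLocalization.map_units K (⟨s, hs⟩ : R⁰)).ne_zero hv hmem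
  exact ⟨Units.mk0 I hI, rfl⟩

theorem exists_apply_eq_one_forall_smul_mem
    (ha : ((a : FractionalIdeal R⁰ K) : Submodule R K) = L.map (f.restrictScalars R)) :
    ∃ e : V, f e = 1 ∧ ∀ c ∈ (a : FractionalIdeal R⁰ K), c • e ∈ L := by
  suffices ∀ t ∈ ((a : FractionalIdeal R⁰ K) * (a : FractionalIdeal R⁰ K)⁻¹ :
      FractionalIdeal R⁰ K),
      ∃ e : V, f e = t ∧ ∀ c ∈ (a : FractionalIdeal R⁰ K), c • e ∈ L from
    this 1 (by rw [mul_inv_cancel₀ a.ne_zero]; exact FractionalIdeal.one_mem_one _)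
  intro t ht
  rw [← FractionalIdeal.mem_coe, FractionalIdeal.coe_mul] at ht
  induction ht using Submodule.mul_induction_on' with
  | mem_mul_mem r hr b hb =>
    obtain ⟨v, hv, rfl⟩ := ha ▸ hr
    refine ⟨b • v, by simp [mul_comm], fun c hc => ?_⟩
    obtain ⟨z, hz⟩ := (FractionalIdeal.mem_one_iff _).mp
      ((FractionalIdeal.mem_inv_iff a.ne_zero).mp hb c hc)
    rw [smul_smul, mul_comm, ← hz, algebraMap_smul]
    exact L.smul_mem z hv
  | add x _ y _ hx hy =>
    obtain ⟨e, rfl, he⟩ := hx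
    obtain ⟨g, rfl, hg⟩ := hy
    refine ⟨e + g, map_add f e g, fun c hc => ?_⟩
    rw [smul_add]
    exact L.add_mem (he c hc) (hg c hc)

theorem exists_isPseudoBasis (n : ℕ) {V : Type u} [AddCommGroup V] [Module K V]
    [FiniteDimensional K V] [Module R V] [IsScalarTower R K V] (hn : finrank K V = n)
    {L : Submodule R V} (hL : L.IsLattice K) :
    ∃ (x : Basis (Fin n) K V) (a : Fin n → (FractionalIdeal R⁰ K)ˣ), IsPseudoBasis x a L := by
  induction n generalizing V with
  | zero =>
    have : Subsingleton V := finrank_zero_iff.mp hn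
    refine ⟨finBasisOfFinrankEq K V hn, fun i => i.elim0, fun v => ?_⟩
    simp [Subsingleton.elim v 0]
  | succ n ih =>
    let b := finBasisOfFinrankEq K V hn
    let f : V →ₗ[K] K := b.coord 0
    have hf : f ≠ 0 := DFunLike.ne_iff.mpr ⟨b 0, by simp [f]⟩
    obtain ⟨a, ha⟩ := exists_fractionalIdeal_eq_map hL hf
    obtain ⟨e, he, hae⟩ := exists_apply_eq_one_forall_smul_mem ha
    have hker : finrank K (LinearMap.ker f) = n := by
      have := LinearMap.finrank_range_add_finrank_ker f
      rw [LinearMap.range_eq_top.mpr (LinearMap.surjective_of_ne_zero hf), finrank_top,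
        finrank_self, hn] at this
      omega
    obtain ⟨y, b, hy⟩ := ih hker (isLattice_comap_subtype hL (LinearMap.ker f))
    have hli : ∀ c : K, ∀ w ∈ LinearMap.ker f, c • e + w = 0 → c = 0 := fun c w hw hc => by
      simpa [he, LinearMap.mem_ker.mp hw] using congrArg f hc
    exact ⟨_, _, isPseudoBasis_mkFinCons ha he hae hy hli fun v => ⟨-f v, by simp [he]⟩⟩

end PseudoBasis

section DetIdeal

variable {R K : Type*} [CommRing R] [Field K] [Algebra R K]

theorem coe_prod_fractionalIdeal {ι : Type*} [Fintype ι]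
    (a : ι → (FractionalIdeal R⁰ K)ˣ) :
    (((∏ i, a i : (FractionalIdeal R⁰ K)ˣ) : FractionalIdeal R⁰ K) : Submodule R K) =
      Submodule.span R (∏ i, ((a i : FractionalIdeal R⁰ K) : Set K)) := by
  rw [← Submodule.prod_span, Units.coe_prod]
  refine (map_prod (FractionalIdeal.coeSubmoduleHom R⁰ K)
    (fun i => (a i : FractionalIdeal R⁰ K)) Finset.univ).trans
    (Finset.prod_congr rfl fun i _ => ?_)
  exact (Submodule.span_eq _).symm

theorem coe_spanSingleton_mul [IsLocalization R⁰ K] (c : K) (I : FractionalIdeal R⁰ K) :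
    ((FractionalIdeal.spanSingleton R⁰ c * I : FractionalIdeal R⁰ K) : Submodule R K) =
      c • (I : Submodule R K) := by
  rw [FractionalIdeal.coe_mul, FractionalIdeal.coe_spanSingleton, Submodule.span_singleton_mul]

variable {V : Type*} [AddCommGroup V] [Module K V] [Module R V]

theorem IsPseudoBasis.smul_mem {ι : Type*} {x : Basis ι K V} {a : ι → (FractionalIdeal R⁰ K)ˣ}
    {L : Submodule R V} (hx : IsPseudoBasis x a L) {i : ι} {c : K}
    (hc : c ∈ (a i : FractionalIdeal R⁰ K)) : c • x i ∈ L := by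
  refine (hx _).mpr fun j => ?_
  classical
  rw [map_smul, x.repr_self, Finsupp.smul_apply, Finsupp.single_apply]
  split_ifs with hij
  · rwa [smul_eq_mul, mul_one, ← hij]
  · rw [smul_zero]
    exact Submodule.zero_mem ((a j : FractionalIdeal R⁰ K) : Submodule R K)

variable {ι : Type*} [Fintype ι] [DecidableEq ι] {L : Submodule R V}

/-- The module spanned by the determinants of the families of vectors of `L`: the top exterior
power of `L`, in terms of a basis of `V`. -/
def detIdeal (b : Basis ι K V) (L : Submodule R V) : Submodule R K :=
  Submodule.span R {y | ∃ v : ι → V, (∀ i, v i ∈ L) ∧ b.det v = y}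

theorem det_mem_detIdeal (b : Basis ι K V) {v : ι → V} (hv : ∀ i, v i ∈ L) :
    b.det v ∈ detIdeal b L :=
  Submodule.subset_span ⟨v, hv, rfl⟩

theorem detIdeal_eq_smul (b x : Basis ι K V) (L : Submodule R V) :
    detIdeal b L = b.det x • detIdeal x L := by
  have hb : ∀ v, b.det v = b.det x * x.det v := fun v =>
    DFunLike.congr_fun (AlternatingMap.eq_smul_basis_det x b.det) v
  rw [detIdeal, detIdeal, ← Submodule.span_smul]
  congr 1
  ext y
  simp only [Set.mem_smul_set, Set.mem_ofPred_eq, smul_eq_mul, exists_exists_and_eq_and, ← hb]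

theorem IsPseudoBasis.detIdeal_eq_prod {x : Basis ι K V} {a : ι → (FractionalIdeal R⁰ K)ˣ}
    (hx : IsPseudoBasis x a L) :
    detIdeal x L = ((∏ i, a i : (FractionalIdeal R⁰ K)ˣ) : FractionalIdeal R⁰ K) := by
  rw [coe_prod_fractionalIdeal]
  refine le_antisymm (Submodule.span_le.mpr ?_) (Submodule.span_mono ?_)
  · rintro _ ⟨v, hv, rfl⟩
    rw [Basis.det_apply, ← Matrix.det_transpose, Matrix.det_apply]
    refine Submodule.sum_mem _ fun σ _ => ?_
    rw [Units.smul_def]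
    exact zsmul_mem (Submodule.subset_span ((Set.mem_fintype_prod _ _).mpr
      ⟨_, fun i => (hx _).mp (hv (σ i)) i, rfl⟩)) _
  · intro y hy
    obtain ⟨g, hg, rfl⟩ := (Set.mem_fintype_prod _ _).mp hy
    refine ⟨fun i => g i • x i, fun i => hx.smul_mem (hg i), ?_⟩
    change x.det.toMultilinearMap (fun i => g i • x i) = _
    rw [MultilinearMap.map_smul_univ]
    simp [Basis.det_self]

end DetIdeal

section Steinitz

theorem mk_eq_mk_iff_exists_smul {R K : Type*} [CommRing R] [IsDomain R] [Field K] [Algebra R K]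
    [IsFractionRing R K] {I J : (FractionalIdeal R⁰ K)ˣ} :
    ClassGroup.mk K J = ClassGroup.mk K I ↔ ∃ d : Kˣ,
      ((J : FractionalIdeal R⁰ K) : Submodule R K) =
        (d : K) • ((I : FractionalIdeal R⁰ K) : Submodule R K) := by
  rw [eq_comm, ← (ClassGroup.equiv K).injective.eq_iff, ClassGroup.equiv_mk, ClassGroup.equiv_mk,
    FractionalIdeal.canonicalEquiv_self, QuotientGroup.mk'_eq_mk']
  simp only [MonoidHom.mem_range, exists_exists_eq_and]
  refine exists_congr fun d => ?_
  rw [← coe_spanSingleton_mul, FractionalIdeal.coeToSubmodule_inj, ← coe_toPrincipalIdeal,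
    ← Units.val_mul, Units.val_inj, mul_comm, eq_comm]
  rfl

variable {K : Type*} [Field K] [NumberField K] {V : Type*} [AddCommGroup V] [Module K V]
  [Module (𝓞 K) V] [IsScalarTower (𝓞 K) K V] [FiniteDimensional K V] {L N : Submodule (𝓞 K) V}

theorem exists_hasSteinitzClass (hL : L.IsLattice K) : ∃ c, HasSteinitzClass L c := by
  obtain ⟨x, a, hx⟩ := exists_isPseudoBasis _ rfl hL
  exact ⟨_, x, a, hx, rfl⟩

theorem exists_eq_detIdeal (hL : L.IsLattice K) (b : Basis (Fin (finrank K V)) K V) :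
    ∃ I : (FractionalIdeal (𝓞 K)⁰ K)ˣ,
      detIdeal b L = (I : FractionalIdeal (𝓞 K)⁰ K) ∧ ClassGroup.mk K I = steinitzClass L := by
  obtain ⟨x, a, hx, hc⟩ : HasSteinitzClass L (steinitzClass L) :=
    Classical.epsilon_spec (exists_hasSteinitzClass hL)
  have hb : detIdeal b L = ((toPrincipalIdeal (𝓞 K) K (b.isUnit_det x).unit * ∏ i, a i :
      (FractionalIdeal (𝓞 K)⁰ K)ˣ) : FractionalIdeal (𝓞 K)⁰ K) := by
    rw [detIdeal_eq_smul b x, IsPseudoBasis.detIdeal_eq_prod hx, Units.val_mul,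
      coe_toPrincipalIdeal, coe_spanSingleton_mul, IsUnit.unit_spec]
  refine ⟨_, hb, Eq.trans (mk_eq_mk_iff_exists_smul.mpr ⟨(b.isUnit_det x).unit, ?_⟩) hc⟩
  rw [← hb, detIdeal_eq_smul b x, IsPseudoBasis.detIdeal_eq_prod hx, IsUnit.unit_spec]

theorem steinitzClass_eq_iff_exists_detIdeal_eq_smul (hL : L.IsLattice K) (hN : N.IsLattice K)
    (b : Basis (Fin (finrank K V)) K V) :
    steinitzClass N = steinitzClass L ↔ ∃ d : Kˣ, detIdeal b N = (d : K) • detIdeal b L := by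
  obtain ⟨I, hI, hIc⟩ := exists_eq_detIdeal hL b
  obtain ⟨J, hJ, hJc⟩ := exists_eq_detIdeal hN b
  rw [← hIc, ← hJc, hI, hJ, mk_eq_mk_iff_exists_smul]

end Steinitz

section Gram

variable {R : Type*} [CommRing R] {τ : R →+* R} {M : Type*} [AddCommGroup M] [Module R M]
  {ι : Type*} [Fintype ι] [DecidableEq ι]

/-- The Gram matrix of a form in terms of a basis. -/
def gram (h : M →ₗ[R] M →ₛₗ[τ] R) (b : Basis ι R M) : Matrix ι ι R :=
  Matrix.of fun i j => h (b i) (b j)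

theorem det_mul_map_det_eq_one {h : M →ₗ[R] M →ₛₗ[τ] R} {b : Basis ι R M}
    (hb : IsUnit (gram h b).det) {σ : M ≃ₗ[R] M} (hσ : σ ∈ unitaryGroup h) :
    (LinearEquiv.det σ : R) * τ (LinearEquiv.det σ : R) = 1 := by
  let S := LinearMap.toMatrix b b (σ : M →ₗ[R] M)
  have hS : ∀ j, σ (b j) = ∑ i, S i j • b i := fun j => by
    rw [← b.sum_repr (σ (b j))]
    simp [S, LinearMap.toMatrix_apply]
  have hgram : Sᵀ * gram h b * S.map τ = gram h b := by
    ext j l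
    change _ = h (b j) (b l)
    rw [← hσ (b j) (b l), hS, hS]
    simp only [map_sum, LinearMap.sum_apply, map_smul, LinearMap.smul_apply, map_smulₛₗ,
      smul_eq_mul, Matrix.mul_apply, Matrix.transpose_apply, Matrix.map_apply, gram,
      Matrix.of_apply, Finset.sum_mul, Finset.mul_sum]
    exact Finset.sum_congr rfl fun i _ => Finset.sum_congr rfl fun k _ => by ring
  have hdet : S.det * (gram h b).det * τ S.det = (gram h b).det := by
    rw [RingHom.map_det, RingHom.mapMatrix_apply]
    simpa only [Matrix.det_mul, Matrix.det_transpose] using congrArg Matrix.det hgram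
  rw [LinearEquiv.coe_det, ← LinearMap.det_toMatrix b]
  exact hb.mul_right_cancel (by linear_combination hdet)

variable {K : Type*} [Field K] {τ : K →+* K} {V : Type*} [AddCommGroup V] [Module K V]
  {h : V →ₗ[K] V →ₛₗ[τ] K}

theorem exists_form_eq_one {ι : Type*} [Finite ι] [DecidableEq ι] (hh : h.SeparatingLeft)
    (b : Basis ι K V) : ∃ u : ι → V, ∀ i j, h (u i) (b j) = (1 : Matrix ι ι K) i j := by
  have := Fintype.ofFinite ι
  let f : V →ₗ[K] ι → K := LinearMap.pi fun j => h.flip (b j)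
  have hf : Function.Injective f := by
    refine (injective_iff_map_eq_zero f).mpr fun w hw => hh w fun v => ?_
    rw [← b.sum_repr v, map_sum]
    refine Finset.sum_eq_zero fun j _ => ?_
    rw [map_smulₛₗ, show h w (b j) = 0 from congrFun hw j, smul_zero]
  have : FiniteDimensional K V := b.finiteDimensional_of_finite
  have hf_surj : Function.Surjective f :=
    (LinearMap.injective_iff_surjective_of_finrank_eq_finrank
      (by rw [finrank_eq_card_basis b, finrank_fintype_fun_eq_card])).mp hf
  choose u hu using fun i => hf_surj ((1 : Matrix ι ι K) i)
  exact ⟨u, fun i j => congrFun (hu i) j⟩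

theorem isUnit_det_gram (hh : h.SeparatingLeft) (b : Basis ι K V) : IsUnit (gram h b).det := by
  obtain ⟨u, hu⟩ := exists_form_eq_one hh b
  refine Matrix.isUnit_det_of_left_inverse (B := Matrix.of fun i k => b.repr (u i) k) ?_
  ext i j
  calc _ = h (∑ k, b.repr (u i) k • b k) (b j) := by
        simp only [Matrix.mul_apply, Matrix.of_apply, gram, map_sum, LinearMap.sum_apply, map_smul,
          LinearMap.smul_apply, smul_eq_mul]
    _ = (1 : Matrix ι ι K) i j := by rw [b.sum_repr, hu]

end Gram

section Unimodular

theorem exists_mul_eq_sub_one_mem {R K : Type*} [CommRing R] [IsDedekindDomain R] [Field K]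
    [Algebra R K] [IsFractionRing R K] (a : (FractionalIdeal R⁰ K)ˣ) {J : Ideal R} (hJ : J ≠ ⊥) :
    ∃ α ∈ (a : FractionalIdeal R⁰ K), ∃ β ∈ (a : FractionalIdeal R⁰ K)⁻¹, ∃ s : R,
      s - 1 ∈ J ∧ algebraMap R K s = β * α := by
  obtain ⟨β, hβ⟩ := IsDedekindDomain.exists_add_spanSingleton_mul_eq
    (FractionalIdeal.coeIdeal_le_one (I := J) (P := K)) (FractionalIdeal.coeIdeal_ne_zero.mpr hJ)
    a.ne_zero
  have hone : (1 : K) ∈ (J : FractionalIdeal R⁰ K) + FractionalIdeal.spanSingleton R⁰ β * a :=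
    hβ ▸ FractionalIdeal.one_mem_one _
  obtain ⟨y, hy, z, hz, hyz⟩ := (FractionalIdeal.mem_add _ _ _).mp hone
  obtain ⟨j, hj, rfl⟩ := (FractionalIdeal.mem_coeIdeal _).mp hy
  obtain ⟨α, hα, rfl⟩ := FractionalIdeal.mem_singleton_mul.mp hz
  refine ⟨α, hα, β, (FractionalIdeal.mem_inv_iff a.ne_zero).mpr fun y hy => ?_, 1 - j, ?_, ?_⟩
  · exact hβ.le <| le_add_self (a := FractionalIdeal.spanSingleton R⁰ β * a)
      (FractionalIdeal.mem_singleton_mul.mpr ⟨y, hy, rfl⟩)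
  · simpa using hj
  · rw [map_sub, map_one, ← hyz, add_sub_cancel_left]

theorem IsPseudoBasis.exists_basis_forall_smul_mem_span {R K V ι : Type*} [CommRing R]
    [IsDedekindDomain R] [Field K] [Algebra R K] [IsFractionRing R K] [AddCommGroup V] [Module K V]
    [Module R V] [IsScalarTower R K V] [Finite ι] {x : Basis ι K V}
    {a : ι → (FractionalIdeal R⁰ K)ˣ} {L : Submodule R V} (hx : IsPseudoBasis x a L) {J : Ideal R}
    (hJ₀ : J ≠ ⊥) (hJ₁ : J ≠ ⊤) :
    ∃ v : Basis ι K V, (∀ i, v i ∈ L) ∧ ∃ s : R, s - 1 ∈ J ∧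
      ∀ w ∈ L, s • w ∈ Submodule.span R (Set.range v) := by
  classical
  have := Fintype.ofFinite ι
  choose α hα β hβ s hsJ hs using fun i => exists_mul_eq_sub_one_mem (a i) hJ₀
  have hα₀ : ∀ i, α i ≠ 0 := by
    intro i hi
    have hsi : s i = 0 := by
      rw [← map_eq_zero_iff _ (IsFractionRing.injective R K), hs, hi, mul_zero]
    refine hJ₁ ((Ideal.eq_top_iff_one J).mpr ?_)
    simpa [hsi] using hsJ i
  let v := x.isUnitSMul fun i => (hα₀ i).isUnit
  have hv : ∀ i, v i = α i • x i := fun i => Basis.isUnitSMul_apply _ i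
  refine ⟨v, fun i => hv i ▸ hx.smul_mem (hα i), ∏ i, s i, ?_, fun w hw => ?_⟩
  · rw [← Ideal.Quotient.mk_eq_mk_iff_sub_mem, map_prod, map_one]
    exact Finset.prod_eq_one fun i _ => Ideal.Quotient.mk_eq_mk_iff_sub_mem _ _ |>.mpr (hsJ i)
  · rw [← x.sum_repr w, Finset.smul_sum]
    refine Submodule.sum_mem _ fun i _ => ?_
    obtain ⟨t, ht⟩ := (FractionalIdeal.mem_one_iff _).mp
      ((FractionalIdeal.mem_inv_iff (a i).ne_zero).mp (hβ i) _ ((hx w).mp hw i))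
    have hsi : s i • x.repr w i • x i = t • v i := by
      rw [hv, ← algebraMap_smul K (s i), ← algebraMap_smul K t, hs, ht, smul_smul, smul_smul]
      congr 1
      ring
    rw [← Finset.prod_erase_mul _ _ (Finset.mem_univ i), mul_smul, hsi]
    exact Submodule.smul_mem _ _ (Submodule.smul_mem _ _ (Submodule.subset_span ⟨i, rfl⟩))

variable {K : Type*} [Field K] [NumberField K] {conj : K ≃ₐ[ℚ] K}
  {V : Type*} [AddCommGroup V] [Module K V] [Module (𝓞 K) V] [IsScalarTower (𝓞 K) K V]
  {h : V →ₗ[K] V →ₛₗ[(conj : K →+* K)] K} {L : Submodule (𝓞 K) V}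

theorem not_finite_ringOfIntegers : ¬ Module.Finite (𝓞 K) K := fun _ =>
  RingOfIntegers.not_isField K (isField_of_isIntegral_of_isField
    (FaithfulSMul.algebraMap_injective (𝓞 K) K) (Field.toIsField K))

theorem exists_eq_form (hL : IsUnimodular h L) {v w : V} (hv : v ∈ L) (hw : w ∈ L) :
    ∃ r : 𝓞 K, (r : K) = h v w :=
  (hL.2.symm ▸ hv : v ∈ dual h L) w hw

-- The dual of `L` contains the radical, which is not finitely generated over `𝓞 K` unless it is
-- zero.
theorem separatingLeft_of_isUnimodular (hL : IsUnimodular h L) : h.SeparatingLeft := by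
  intro w hw
  by_contra hw₀
  have hmem : ∀ c : K, c • w ∈ L := fun c => by
    rw [← hL.2]
    exact fun y _ => ⟨0, by simp [hw]⟩
  let f : K →ₗ[𝓞 K] L :=
    ((LinearMap.toSpanSingleton K V w).restrictScalars (𝓞 K)).codRestrict L hmem
  have hf : Function.Injective f := fun c c' hcc =>
    smul_left_injective K hw₀ (congrArg Subtype.val hcc)
  have : Module.Finite (𝓞 K) L := Module.Finite.iff_fg.mpr hL.1.fg
  exact not_finite_ringOfIntegers (Module.Finite.of_injective f hf)

variable {ι : Type*} [Fintype ι] [DecidableEq ι]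

theorem exists_mul_eq_smul_one (hL : IsUnimodular h L) {v : Basis ι K V} {s : 𝓞 K}
    (hs : ∀ w ∈ L, s • w ∈ Submodule.span (𝓞 K) (Set.range v)) {A : Matrix ι ι (𝓞 K)}
    (hA : ∀ i j, (A i j : K) = h (v i) (v j)) :
    ∃ C : Matrix ι ι (𝓞 K),
      C * A = (s * RingOfIntegers.mapRingHom (conj : K →+* K) s) • 1 := by
  let τ : 𝓞 K →+* 𝓞 K := RingOfIntegers.mapRingHom (conj : K →+* K)
  obtain ⟨u, hu⟩ := exists_form_eq_one (separatingLeft_of_isUnimodular hL) v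
  have huL : ∀ i, τ s • u i ∈ L := by
    intro i
    rw [← hL.2]
    intro y hy
    obtain ⟨c, hc⟩ := (Submodule.mem_span_range_iff_exists_fun _).mp (hs y hy)
    refine ⟨τ (c i), ?_⟩
    calc ((τ (c i) : 𝓞 K) : K) = h (u i) (∑ k, c k • v k) := by
          simp [← algebraMap_smul K, τ, hu, Matrix.one_apply, RingOfIntegers.mapRingHom_apply]
      _ = h (τ s • u i) y := by
          rw [hc, ← algebraMap_smul K s, ← algebraMap_smul K (τ s), map_smulₛₗ, map_smul]
          rfl
  choose C hC using fun i => (Submodule.mem_span_range_iff_exists_fun _).mp (hs _ (huL i))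
  refine ⟨Matrix.of C, ?_⟩
  ext i j
  calc ((Matrix.of C * A) i j : K) = h (∑ k, C i k • v k) (v j) := by
        simp [Matrix.mul_apply, hA, ← algebraMap_smul K]
    _ = ((s * τ s) • (1 : Matrix ι ι (𝓞 K))) i j := by
        rw [hC, ← mul_smul, ← algebraMap_smul K, map_smul, LinearMap.smul_apply, hu,
          Matrix.smul_apply, Matrix.one_apply, Matrix.one_apply]
        split_ifs <;> simp

variable [Algebra.IsQuadraticExtension ℚ K]

theorem det_mem_span_of_forall_dvd (hconj : conj ≠ 1) (hh : IsHermitian h)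
    (hι : Odd (Fintype.card ι)) (hL : IsUnimodular h L) {m : ℤ}
    (hm : ∀ v ∈ L, ∀ k : ℤ, (k : K) = h v v → m ∣ k) {v : ι → V} (hv : ∀ i, v i ∈ L)
    {A : Matrix ι ι (𝓞 K)} (hA : ∀ i j, (A i j : K) = h (v i) (v j)) :
    A.det ∈ Ideal.span {(m : 𝓞 K)} := by
  let τ : 𝓞 K →+* 𝓞 K := RingOfIntegers.mapRingHom (conj : K →+* K)
  let J : Ideal (𝓞 K) := Ideal.span {(m : 𝓞 K)}
  have hτ : ∀ {r : 𝓞 K} {x y : V}, (r : K) = h x y → (τ r : K) = h y x := fun hr =>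
    (congrArg conj hr).trans (hh _ _).symm
  have hnorm : ∀ x ∈ L, ∀ r : 𝓞 K, (r : K) = h x x → r ∈ J := by
    intro x hx r hr
    obtain ⟨k, rfl⟩ := exists_intCast_eq_of_conj_eq hconj ((hτ hr).trans hr.symm)
    exact Ideal.mem_span_singleton.mpr
      (map_dvd (Int.castRingHom (𝓞 K)) (hm x hx k (by simpa using hr)))
  have htrace : ∀ x ∈ L, ∀ y ∈ L, ∀ r : 𝓞 K, (r : K) = h x y → r + τ r ∈ J := by
    intro x hx y hy r hr
    obtain ⟨a, ha⟩ := exists_eq_form hL hx hx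
    obtain ⟨b, hb⟩ := exists_eq_form hL hy hy
    have hab : a + (r + τ r) + b ∈ J := hnorm (x + y) (L.add_mem hx hy) _ (by
      simp only [map_add, LinearMap.add_apply, ha, hb, hr, hτ hr]
      ring)
    rwa [J.add_mem_iff_left (hnorm y hy b hb), J.add_mem_iff_right (hnorm x hx a ha)] at hab
  refine det_mem_of_odd_card (τ := τ) hι (fun i j => ?_) (fun i => hnorm _ (hv i) _ (hA i i))
    (fun r i j => htrace (r • v i) (L.smul_mem r (hv i)) (v j) (hv j) _ ?_)
  · ext
    rw [hA, hτ (hA i j)]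
  · rw [← algebraMap_smul K r, map_smul, LinearMap.smul_apply, ← hA i j]
    exact map_mul (algebraMap (𝓞 K) K) r (A i j)

-- Otherwise polarization makes the traces of all values of `h` divisible by `m` too, so the Gram
-- determinant of every basis in `L` lies in `(m)`; but that of a basis spanning `L` locally at `m`
-- is a unit modulo `m`.
theorem exists_norm_not_dvd [FiniteDimensional K V] (hconj : conj ≠ 1) (hh : IsHermitian h)
    (hn : Odd (finrank K V)) (hL : IsUnimodular h L) {m : ℤ} (hm₀ : m ≠ 0) (hm : ¬ IsUnit m) :
    ∃ v ∈ L, ∃ k : ℤ, (k : K) = h v v ∧ ¬ m ∣ k := by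
  by_contra! hnorm
  let J : Ideal (𝓞 K) := Ideal.span {(m : 𝓞 K)}
  have hJ₀ : J ≠ ⊥ := by simpa [J] using hm₀
  have hJ₁ : J ≠ ⊤ := by
    rw [Ne, Ideal.span_singleton_eq_top, ← eq_intCast (algebraMap ℤ (𝓞 K)), isUnit_map_iff]
    exact hm
  obtain ⟨x, a, hx⟩ := exists_isPseudoBasis _ rfl hL.1
  obtain ⟨v, hvL, s, hsJ, hs⟩ := hx.exists_basis_forall_smul_mem_span hJ₀ hJ₁
  choose A hA using fun i j => exists_eq_form hL (hvL i) (hvL j)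
  obtain ⟨C, hC⟩ := exists_mul_eq_smul_one hL hs (A := Matrix.of A) hA
  let τ : 𝓞 K →+* 𝓞 K := RingOfIntegers.mapRingHom (conj : K →+* K)
  have hdet : (s * τ s) ^ finrank K V ∈ J := by
    have hCdet := congrArg Matrix.det hC
    rw [Matrix.det_mul, Matrix.det_smul, Matrix.det_one, mul_one, Fintype.card_fin] at hCdet
    exact hCdet ▸ J.mul_mem_left _
      (det_mem_span_of_forall_dvd hconj hh (by rwa [Fintype.card_fin]) hL hnorm hvL hA)
  have hτsJ : τ s - 1 ∈ J := by
    obtain ⟨t, ht⟩ := Ideal.mem_span_singleton.mp hsJ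
    rw [← map_one τ, ← map_sub, ht, map_mul, map_intCast]
    exact Ideal.mem_span_singleton.mpr (dvd_mul_right _ _)
  refine hJ₁ ((Ideal.eq_top_iff_one J).mpr ?_)
  rw [← Ideal.Quotient.mk_eq_mk_iff_sub_mem, map_one] at hsJ hτsJ
  rw [← Ideal.Quotient.eq_zero_iff_mem] at hdet ⊢
  rwa [map_pow, map_mul, hsJ, hτsJ, one_mul, one_pow] at hdet

end Unimodular

section Local

theorem exists_intCast_eq_of_forall_norm_le_one {q : ℚ}
    (hq : ∀ (p : ℕ) [Fact p.Prime], ‖(q : ℚ_[p])‖ ≤ 1) : ∃ m : ℤ, (m : ℚ) = q := by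
  refine ⟨q.num, Rat.den_eq_one_iff q |>.mp ?_⟩
  by_contra hden
  obtain ⟨p, hp, hpden⟩ := Nat.exists_prime_and_dvd hden
  have : Fact p.Prime := ⟨hp⟩
  have hunit : IsUnit ((q.den : ℤ) : ℤ_[p]) := by
    simpa only [Int.cast_natCast] using PadicInt.isUnit_den q (hq p)
  rw [PadicInt.isUnit_iff] at hunit
  exact hunit.not_lt (PadicInt.norm_int_lt_one_iff_dvd _ |>.mpr (Int.natCast_dvd_natCast.mpr hpden))

variable {K : Type*} [Field K] [NumberField K] {conj : K ≃ₐ[ℚ] K} {p : ℕ} [Fact p.Prime]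

theorem tmul_mem_localInt (r : 𝓞 K) (z : ℤ_[p]) :
    (r : K) ⊗ₜ[ℚ] (z : ℚ_[p]) ∈ localInt K p :=
  ⟨r ⊗ₜ[ℤ] z, by simp⟩

theorem algebraMap_mem_localInt (r : 𝓞 K) : algebraMap K (LocalAlg K p) r ∈ localInt K p :=
  tmul_mem_localInt r 1

theorem localInt_induction {P : (x : LocalAlg K p) → x ∈ localInt K p → Prop}
    (zero : P 0 (zero_mem _))
    (add : ∀ x y hx hy, P x hx → P y hy → P (x + y) (add_mem hx hy))
    (tmul : ∀ (r : 𝓞 K) (z : ℤ_[p]), P ((r : K) ⊗ₜ[ℚ] (z : ℚ_[p])) (tmul_mem_localInt r z))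
    {x : LocalAlg K p} (hx : x ∈ localInt K p) : P x hx := by
  obtain ⟨t, rfl⟩ := hx
  induction t using TensorProduct.induction_on with
  | zero => simpa using zero
  | add s t hs ht => simpa using add _ _ ⟨s, rfl⟩ ⟨t, rfl⟩ hs ht
  | tmul r z => simpa using tmul r z

theorem localConj_mem_localInt {w : LocalAlg K p} (hw : w ∈ localInt K p) :
    localConj p conj w ∈ localInt K p := by
  induction hw using localInt_induction with
  | zero => exact map_zero (localConj p conj) ▸ zero_mem _
  | add x y _ _ hx hy => exact map_add (localConj p conj) x y ▸ add_mem hx hy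
  | tmul r z => exact tmul_mem_localInt (RingOfIntegers.mapRingHom (conj : K →+* K) r) z

theorem inv_intCast_mem_localInt {m : ℤ} (hm : ¬ (p : ℤ) ∣ m) :
    algebraMap K (LocalAlg K p) (m : K)⁻¹ ∈ localInt K p := by
  have hnorm : ‖(m : ℚ_[p])⁻¹‖ ≤ 1 := by
    have hm' : ¬ ‖(m : ℚ_[p])‖ < 1 := Padic.norm_intCast_lt_one_iff.not.mpr hm
    rw [norm_inv]
    exact inv_le_one_of_one_le₀ (not_lt.mp hm')
  have heq : algebraMap K (LocalAlg K p) (m : K)⁻¹ = (1 : K) ⊗ₜ[ℚ] (m : ℚ_[p])⁻¹ :=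
    calc (m : K)⁻¹ ⊗ₜ[ℚ] (1 : ℚ_[p]) = ((m : ℚ)⁻¹ • (1 : K)) ⊗ₜ[ℚ] (1 : ℚ_[p]) := by
          simp [Algebra.smul_def]
      _ = (1 : K) ⊗ₜ[ℚ] ((m : ℚ)⁻¹ • (1 : ℚ_[p])) := TensorProduct.smul_tmul _ _ _
      _ = (1 : K) ⊗ₜ[ℚ] (m : ℚ_[p])⁻¹ := by simp [Algebra.smul_def]
  rw [heq]
  exact tmul_mem_localInt 1 ⟨_, hnorm⟩

variable (K p) in
/-- The group of units of `𝔬_p`, as a subgroup of the units of `K_p`. -/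
def localUnits : Subgroup (LocalAlg K p)ˣ :=
  (localInt K p).toSubmonoid.units

theorem map_localConj_mem_localUnits {u : (LocalAlg K p)ˣ} (hu : u ∈ localUnits K p) :
    Units.map (localConj p conj : LocalAlg K p →* LocalAlg K p) u ∈ localUnits K p :=
  ⟨localConj_mem_localInt hu.1, localConj_mem_localInt hu.2⟩

variable (p) in
/-- The `𝔬_p`-submodule of `K_p` generated by an `𝔬`-submodule of `K`. -/
def localIdeal (I : Submodule (𝓞 K) K) : Submodule (localInt K p) (LocalAlg K p) :=
  Submodule.span (localInt K p) (algebraMap K (LocalAlg K p) '' (I : Set K))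

variable {I : Submodule (𝓞 K) K}

theorem algebraMap_mem_localIdeal {y : K} (hy : y ∈ I) :
    algebraMap K (LocalAlg K p) y ∈ localIdeal p I :=
  Submodule.subset_span ⟨y, hy, rfl⟩

theorem tmul_mul_algebraMap (r : 𝓞 K) (z : ℤ_[p]) (y : K) :
    (r : K) ⊗ₜ[ℚ] (z : ℚ_[p]) * algebraMap K (LocalAlg K p) y = (r • y) ⊗ₜ[ℚ] (z : ℚ_[p]) := by
  rw [Algebra.TensorProduct.algebraMap_apply, Algebra.TensorProduct.tmul_mul_tmul, mul_one,
    Algebra.smul_def]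
  rfl

theorem tmul_mem_localIdeal {y : K} (hy : y ∈ I) (z : ℤ_[p]) :
    y ⊗ₜ[ℚ] (z : ℚ_[p]) ∈ localIdeal p I := by
  have := Submodule.smul_mem _ (⟨_, tmul_mem_localInt 1 z⟩ : localInt K p)
    (algebraMap_mem_localIdeal (p := p) hy)
  rwa [Subalgebra.smul_def, smul_eq_mul, tmul_mul_algebraMap, one_smul] at this

theorem localIdeal_induction {P : (x : LocalAlg K p) → x ∈ localIdeal p I → Prop}
    (zero : P 0 (zero_mem _))
    (add : ∀ x y hx hy, P x hx → P y hy → P (x + y) (add_mem hx hy))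
    (tmul : ∀ y (hy : y ∈ I) (z : ℤ_[p]), P (y ⊗ₜ[ℚ] (z : ℚ_[p])) (tmul_mem_localIdeal hy z))
    {x : LocalAlg K p} (hx : x ∈ localIdeal p I) : P x hx := by
  induction hx using Submodule.closure_induction with
  | zero => exact zero
  | add x y hx hy hPx hPy => exact add x y hx hy hPx hPy
  | smul_mem c x hx =>
    obtain ⟨y, hy, rfl⟩ := hx
    obtain ⟨c, hc⟩ := c
    simp only [Subalgebra.smul_def, smul_eq_mul]
    induction hc using localInt_induction with
    | zero => simpa using zero
    | add c d hc hd hPc hPd => simpa only [add_mul] using add _ _ _ _ hPc hPd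
    | tmul r z => simpa only [tmul_mul_algebraMap] using tmul _ (I.smul_mem r hy) z

theorem norm_lift_le_one {φ : K →ₗ[ℚ] ℚ} (hφ : ∀ y ∈ I, ∃ m : ℤ, (m : ℚ) = φ y)
    {x : LocalAlg K p} (hx : x ∈ localIdeal p I) :
    ‖TensorProduct.lift ((LinearMap.lsmul ℚ ℚ_[p]).comp φ) x‖ ≤ 1 := by
  induction hx using localIdeal_induction with
  | zero => simp
  | add x y _ _ hx hy =>
    rw [map_add]
    exact (Padic.nonarchimedean _ _).trans (max_le hx hy)
  | tmul y hy z =>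
    obtain ⟨m, hm⟩ := hφ y hy
    rw [TensorProduct.lift.tmul, LinearMap.comp_apply, ← hm, LinearMap.lsmul_apply,
      Algebra.smul_def, norm_mul]
    exact mul_le_one₀ (by simpa using Padic.norm_int_le_one m) (norm_nonneg _) z.norm_le_one

theorem mem_of_forall_mem_localIdeal (I : (FractionalIdeal (𝓞 K)⁰ K)ˣ) {y : K}
    (hy : ∀ (p : ℕ) [Fact p.Prime], algebraMap K (LocalAlg K p) y ∈
      localIdeal p ((I : FractionalIdeal (𝓞 K)⁰ K) : Submodule (𝓞 K) K)) :
    y ∈ (I : FractionalIdeal (𝓞 K)⁰ K) := by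
  let e := basisOfFractionalIdeal K I
  have hmem : ∀ z, z ∈ (I : FractionalIdeal (𝓞 K)⁰ K) ↔ ∀ i, ∃ m : ℤ, (m : ℚ) = e.repr z i :=
    fun z => (mem_span_basisOfFractionalIdeal K).symm.trans (e.mem_span_iff_repr_mem ℤ z)
  refine (hmem y).mpr fun i => exists_intCast_eq_of_forall_norm_le_one fun p _ => ?_
  have := norm_lift_le_one (φ := e.coord i) (fun z hz => (hmem z).mp hz i) (hy p)
  rw [Algebra.TensorProduct.algebraMap_apply] at this
  simpa [Algebra.smul_def] using this

theorem exists_unit_eq_of_forall_mem_localUnits {e : Kˣ}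
    (he : ∀ (p : ℕ) [Fact p.Prime],
      Units.map (algebraMap K (LocalAlg K p) : K →* LocalAlg K p) e ∈ localUnits K p) :
    ∃ u : (𝓞 K)ˣ, ((u : 𝓞 K) : K) = e := by
  have hint : ∀ y : K, (∀ (p : ℕ) [Fact p.Prime], algebraMap K (LocalAlg K p) y ∈ localInt K p) →
      ∃ r : 𝓞 K, (r : K) = y := by
    intro y hy
    refine (FractionalIdeal.mem_one_iff _).mp (mem_of_forall_mem_localIdeal 1 fun p _ => ?_)
    have hone : algebraMap K (LocalAlg K p) 1 ∈ localIdeal p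
        (((1 : (FractionalIdeal (𝓞 K)⁰ K)ˣ) : FractionalIdeal (𝓞 K)⁰ K) : Submodule (𝓞 K) K) :=
      algebraMap_mem_localIdeal (FractionalIdeal.one_mem_one _)
    simpa [Subalgebra.smul_def] using Submodule.smul_mem _ (⟨_, hy p⟩ : localInt K p) hone
  obtain ⟨r, hr⟩ := hint e fun p _ => (he p).1
  obtain ⟨s, hs⟩ := hint (e⁻¹ : Kˣ) fun p _ => (he p).2
  refine ⟨Units.mkOfMulEqOne r s ?_, hr⟩
  ext
  exact (map_mul (algebraMap (𝓞 K) K) r s).trans (by simp [hr, hs])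

theorem mul_algebraMap_mem_localInt {I : (FractionalIdeal (𝓞 K)⁰ K)ˣ} {z : LocalAlg K p}
    (hz : z ∈ localIdeal p ((I : FractionalIdeal (𝓞 K)⁰ K) : Submodule (𝓞 K) K)) {β : K}
    (hβ : β ∈ (I : FractionalIdeal (𝓞 K)⁰ K)⁻¹) :
    z * algebraMap K (LocalAlg K p) β ∈ localInt K p := by
  induction hz using localIdeal_induction with
  | zero =>
    rw [zero_mul]
    exact zero_mem _
  | add x y _ _ hx hy => exact (add_mul x y _).symm ▸ add_mem hx hy
  | tmul y hy z =>
    obtain ⟨t, ht⟩ := (FractionalIdeal.mem_one_iff _).mp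
      ((FractionalIdeal.mem_inv_iff I.ne_zero).mp hβ y hy)
    rw [Algebra.TensorProduct.algebraMap_apply, Algebra.TensorProduct.tmul_mul_tmul, mul_one,
      Algebra.algebraMap_self_apply, mul_comm, ← ht]
    exact tmul_mem_localInt t z

-- `w` is integral at `p` because `1` is a sum of products of elements of `I` and `I⁻¹`.
theorem mem_localInt_of_mul_mem (I : (FractionalIdeal (𝓞 K)⁰ K)ˣ) {w : LocalAlg K p}
    (hw : ∀ y ∈ (I : FractionalIdeal (𝓞 K)⁰ K), w * algebraMap K (LocalAlg K p) y ∈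
      localIdeal p ((I : FractionalIdeal (𝓞 K)⁰ K) : Submodule (𝓞 K) K)) : w ∈ localInt K p := by
  have hmul : ∀ t ∈ (I : FractionalIdeal (𝓞 K)⁰ K) * (I : FractionalIdeal (𝓞 K)⁰ K)⁻¹,
      w * algebraMap K (LocalAlg K p) t ∈ localInt K p := by
    intro t ht
    rw [← FractionalIdeal.mem_coe, FractionalIdeal.coe_mul] at ht
    induction ht using Submodule.mul_induction_on' with
    | mem_mul_mem y hy β hβ =>
      rw [map_mul, ← mul_assoc]
      exact mul_algebraMap_mem_localInt (hw y hy) hβ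
    | add s _ t _ hs ht =>
      rw [map_add, mul_add]
      exact add_mem hs ht
  have hone := hmul 1 (by
    rw [mul_inv_cancel₀ I.ne_zero]
    exact FractionalIdeal.one_mem_one _)
  rwa [map_one, mul_one] at hone

end Local

section LocalDet

theorem map_mem_of_forall_mem_span {R A M ι : Type*} [CommSemiring R] [CommSemiring A] [Algebra R A]
    [AddCommMonoid M] [Module A M] [Module R M] [IsScalarTower R A M] [Finite ι]
    (f : MultilinearMap A (fun _ : ι => M) A) {S : Set M} {P : Submodule R A}
    (hS : ∀ v : ι → M, (∀ i, v i ∈ S) → f v ∈ P) {v : ι → M}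
    (hv : ∀ i, v i ∈ Submodule.span R S) : f v ∈ P := by
  classical
  have := Fintype.ofFinite ι
  suffices H : ∀ (s : Finset ι) (v : ι → M), (∀ i ∈ s, v i ∈ Submodule.span R S) →
      (∀ i ∉ s, v i ∈ S) → f v ∈ P from H Finset.univ v (fun i _ => hv i) (by simp)
  intro s
  induction s using Finset.induction_on with
  | empty => exact fun v _ hv => hS v (by simpa using hv)
  | insert i s his ih =>
    intro v hvs hvS
    have hupdate : ∀ y ∈ Submodule.span R S, f (Function.update v i y) ∈ P := by
      intro y hy
      induction hy using Submodule.span_induction with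
      | mem y hy =>
        refine ih _ (fun j hj => ?_) (fun j hj => ?_)
        · rw [Function.update_of_ne (ne_of_mem_of_not_mem hj his)]
          exact hvs j (Finset.mem_insert_of_mem hj)
        · rcases eq_or_ne j i with rfl | hji
          · rwa [Function.update_self]
          · rw [Function.update_of_ne hji]
            exact hvS j (by simp [hji, hj])
      | zero => exact f.map_update_zero v i ▸ P.zero_mem
      | add y z _ _ hy hz => exact f.map_update_add v i y z ▸ P.add_mem hy hz
      | smul c y _ hy =>
        rw [← algebraMap_smul A c y, f.map_update_smul, algebraMap_smul]
        exact P.smul_mem c hy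
    simpa only [Function.update_eq_self] using hupdate (v i) (hvs i (Finset.mem_insert_self i s))

variable {ι : Type*} [Fintype ι] [DecidableEq ι]

theorem det_basis_tmul {R A M : Type*} [CommRing R] [CommRing A] [Algebra R A] [AddCommGroup M]
    [Module R M] (b : Basis ι R M) (v : ι → M) :
    (Algebra.TensorProduct.basis A b).det (fun i => (1 : A) ⊗ₜ[R] v i) =
      algebraMap R A (b.det v) := by
  rw [Basis.det_apply, Basis.det_apply, RingHom.map_det]
  congr 1
  ext i j
  simp [Basis.toMatrix_apply]

variable {K : Type*} [Field K] [NumberField K] {p : ℕ} [Fact p.Prime]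
  {V : Type*} [AddCommGroup V] [Module K V] [Module (𝓞 K) V] {L N : Submodule (𝓞 K) V}
  {σ : LocalSpace K p V ≃ₗ[LocalAlg K p] LocalSpace K p V}

theorem det_mem_localIdeal (b : Basis ι K V) {w : ι → LocalSpace K p V}
    (hw : ∀ i, w i ∈ localLattice L p) :
    (Algebra.TensorProduct.basis (LocalAlg K p) b).det w ∈ localIdeal p (detIdeal b L) := by
  refine map_mem_of_forall_mem_span
    (Algebra.TensorProduct.basis (LocalAlg K p) b).det.toMultilinearMap (fun v hv => ?_) hw
  choose v' hv' hv'v using hv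
  obtain rfl : (fun i => (1 : LocalAlg K p) ⊗ₜ[K] v' i) = v := funext hv'v
  exact (det_basis_tmul (A := LocalAlg K p) b v').symm ▸
    algebraMap_mem_localIdeal (det_mem_detIdeal b hv')

theorem inv_det_mul_mem_localIdeal (b : Basis ι K V)
    (hσ : (localLattice N p : Set (LocalSpace K p V)) = σ '' (localLattice L p : Set _)) {y : K}
    (hy : y ∈ detIdeal b N) :
    (((LinearEquiv.det σ)⁻¹ : (LocalAlg K p)ˣ) : LocalAlg K p) * algebraMap K (LocalAlg K p) y ∈
      localIdeal p (detIdeal b L) := by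
  induction hy using Submodule.span_induction with
  | zero => simp
  | add x y _ _ hx hy => rw [map_add, mul_add]; exact Submodule.add_mem _ hx hy
  | smul c x _ hx =>
    rw [Algebra.smul_def, map_mul, mul_left_comm]
    exact Submodule.smul_mem _ (⟨_, algebraMap_mem_localInt c⟩ : localInt K p) hx
  | mem x hx =>
    obtain ⟨v, hv, rfl⟩ := hx
    have hmem : ∀ i, (1 : LocalAlg K p) ⊗ₜ[K] v i ∈ σ '' (localLattice L p : Set _) := fun i =>
      hσ ▸ Submodule.subset_span ⟨v i, hv i, rfl⟩
    choose w hw hwv using hmem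
    have hdet : algebraMap K (LocalAlg K p) (b.det v) =
        LinearEquiv.det σ * (Algebra.TensorProduct.basis (LocalAlg K p) b).det w := by
      rw [← det_basis_tmul, LinearEquiv.coe_det, ← Basis.det_comp]
      exact congrArg _ (funext fun i => (hwv i).symm)
    rw [hdet, Units.inv_mul_cancel_left]
    exact det_mem_localIdeal b hw

variable [IsScalarTower (𝓞 K) K V] [FiniteDimensional K V]

theorem inv_det_mul_mem_localInt (hL : L.IsLattice K) (b : Basis (Fin (finrank K V)) K V)
    (hσ : (localLattice N p : Set (LocalSpace K p V)) = σ '' (localLattice L p : Set _)) {d : Kˣ}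
    (hd : detIdeal b N = (d : K) • detIdeal b L) :
    (((LinearEquiv.det σ)⁻¹ : (LocalAlg K p)ˣ) : LocalAlg K p) * algebraMap K (LocalAlg K p) d ∈
      localInt K p := by
  obtain ⟨I, hI, -⟩ := exists_eq_detIdeal hL b
  refine mem_localInt_of_mul_mem I fun y hy => ?_
  rw [mul_assoc, ← map_mul, ← hI]
  refine inv_det_mul_mem_localIdeal b hσ ?_
  rw [hd, hI]
  exact Submodule.smul_mem_pointwise_smul y (d : K) _ hy

theorem inv_det_mul_mem_localUnits (hL : L.IsLattice K) (hN : N.IsLattice K)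
    (b : Basis (Fin (finrank K V)) K V)
    (hσ : (localLattice N p : Set (LocalSpace K p V)) = σ '' (localLattice L p : Set _)) {d : Kˣ}
    (hd : detIdeal b N = (d : K) • detIdeal b L) :
    (LinearEquiv.det σ)⁻¹ * Units.map (algebraMap K (LocalAlg K p) : K →* LocalAlg K p) d ∈
      localUnits K p := by
  refine ⟨inv_det_mul_mem_localInt hL b hσ hd, ?_⟩
  have hinv := inv_det_mul_mem_localInt (d := d⁻¹) (σ := σ.symm) hN b
    ((σ.toEquiv.eq_image_iff_symm_image_eq _ _).mp hσ).symm
    (by rw [hd, smul_smul, Units.inv_mul, one_smul])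
  rw [LinearEquiv.det_symm, map_inv, inv_inv] at hinv
  change ((((LinearEquiv.det σ)⁻¹ * _)⁻¹ : (LocalAlg K p)ˣ) : LocalAlg K p) ∈ localInt K p
  rwa [mul_inv, inv_inv, ← map_inv]

end LocalDet

section Orbits

universe v

theorem mk_image_eq_mk_image {α : Type*} {β γ : Type v} {f : α → β} {g : α → γ}
    {A B : Set α} (hAB : A ⊆ B) (hB : ∀ b ∈ B, ∃ a ∈ A, g a = g b)
    (hfg : ∀ a ∈ A, ∀ a' ∈ A, f a = f a' ↔ g a = g a') :
    Cardinal.mk (f '' A) = Cardinal.mk (g '' B) := by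
  have himage : g '' A = g '' B := (Set.image_mono hAB).antisymm <| by
    rintro _ ⟨b, hb, rfl⟩
    exact hB b hb
  choose r hr hfr using fun y : f '' A => y.2
  rw [← himage]
  refine Cardinal.mk_congr (Equiv.ofBijective (fun y => ⟨g (r y), r y, hr y, rfl⟩) ⟨?_, ?_⟩)
  · intro y z hyz
    have : f (r y) = f (r z) := (hfg _ (hr y) _ (hr z)).mpr (congrArg Subtype.val hyz)
    exact Subtype.ext <| (hfr y).symm.trans <| this.trans (hfr z)
  · rintro ⟨_, a, ha, rfl⟩
    exact ⟨⟨f a, a, ha, rfl⟩, Subtype.ext <| (hfg _ (hr _) _ ha).mp (hfr _)⟩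

variable {K : Type*} [Field K] {V : Type*} [AddCommGroup V] [Module K V] [Module (𝓞 K) V]
  {L N : Submodule (𝓞 K) V}

theorem setOf_image_eq_iff (G : Subgroup (V ≃ₗ[K] V)) :
    {X : Submodule (𝓞 K) V | ∃ ρ ∈ G, (X : Set V) = ρ '' (N : Set V)} =
        {X : Submodule (𝓞 K) V | ∃ ρ ∈ G, (X : Set V) = ρ '' (L : Set V)} ↔
      ∃ σ ∈ G, (N : Set V) = σ '' (L : Set V) := by
  constructor
  · intro heq
    have hN : N ∈ {X : Submodule (𝓞 K) V | ∃ ρ ∈ G, (X : Set V) = ρ '' (N : Set V)} :=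
      ⟨1, one_mem G, (Set.image_id _).symm⟩
    rwa [heq] at hN
  · rintro ⟨σ, hσ, hN⟩
    ext X
    refine ⟨fun ⟨ρ, hρ, hX⟩ => ⟨ρ * σ, mul_mem hρ hσ, ?_⟩,
      fun ⟨ρ, hρ, hX⟩ => ⟨ρ * σ⁻¹, mul_mem hρ (inv_mem hσ), ?_⟩⟩
    · rw [hX, hN, Set.image_image]
      rfl
    · rw [hX, hN, Set.image_image]
      exact Set.image_congr fun v _ => congrArg ρ (σ.symm_apply_apply v).symm

section Cls

variable [NumberField K] {conj : K ≃ₐ[ℚ] K} {h : V →ₗ[K] V →ₛₗ[(conj : K →+* K)] K}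

theorem cls_eq_cls_iff : cls h N = cls h L ↔ N ∈ cls h L :=
  setOf_image_eq_iff (unitaryGroup h)

theorem specialCls_eq_specialCls_iff : specialCls h N = specialCls h L ↔ N ∈ specialCls h L :=
  setOf_image_eq_iff (specialUnitaryGroup h)

end Cls

variable [IsScalarTower (𝓞 K) K V]

theorem isLattice_map (hN : N.IsLattice K) (σ : V ≃ₗ[K] V) :
    (N.map ((σ : V →ₗ[K] V).restrictScalars (𝓞 K))).IsLattice K := by
  refine ⟨hN.fg.map _, ?_⟩
  change Submodule.span K ((σ : V →ₗ[K] V) '' (N : Set V)) = ⊤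
  rw [← Submodule.map_span, hN.span_eq_top, Submodule.map_top, LinearEquiv.range]

theorem coe_eq_smulOfUnit_image (u : (𝓞 K)ˣ) (N : Submodule (𝓞 K) V) :
    (N : Set V) = LinearEquiv.smulOfUnit (M := V) (Units.map (algebraMap (𝓞 K) K : 𝓞 K →* K) u) ''
      (N : Set V) := by
  have hsmul : ∀ v : V, LinearEquiv.smulOfUnit (Units.map (algebraMap (𝓞 K) K : 𝓞 K →* K) u) v =
      (u : 𝓞 K) • v := fun v => algebraMap_smul K (u : 𝓞 K) v
  ext v
  refine ⟨fun hv => ⟨(↑u⁻¹ : 𝓞 K) • v, N.smul_mem _ hv, ?_⟩, ?_⟩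
  · rw [hsmul, smul_smul, Units.mul_inv, one_smul]
  · rintro ⟨w, hw, rfl⟩
    rw [hsmul]
    exact N.smul_mem _ hw

end Orbits

section Scaling

variable {R : Type*} [CommRing R] {τ : R →+* R} {M : Type*} [AddCommGroup M] [Module R M]
  {h : M →ₗ[R] M →ₛₗ[τ] R}

theorem smulOfUnit_mem_unitaryGroup {u : Rˣ} (hu : (u : R) * τ u = 1) :
    LinearEquiv.smulOfUnit u ∈ unitaryGroup h := fun v w =>
  calc h ((u : R) • v) ((u : R) • w) = (u : R) * τ u * h v w := by
        simp only [map_smul, map_smulₛₗ, LinearMap.smul_apply, smul_eq_mul]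
        ring
    _ = h v w := by rw [hu, one_mul]

theorem det_smulOfUnit [Module.Free R M] (u : Rˣ) :
    LinearEquiv.det (LinearEquiv.smulOfUnit u : M ≃ₗ[R] M) = u ^ finrank R M := by
  ext
  have : ((LinearEquiv.smulOfUnit u : M ≃ₗ[R] M) : M →ₗ[R] M) = (u : R) • LinearMap.id := rfl
  rw [LinearEquiv.coe_det, this, LinearMap.det_smul, LinearMap.det_id, mul_one,
    Units.val_pow_eq_pow_val]

end Scaling

section LocalUnitary

variable {K : Type*} [Field K] [NumberField K] {conj : K ≃ₐ[ℚ] K} {p : ℕ} [Fact p.Prime]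
  {V : Type*} [AddCommGroup V] [Module K V] {h : V →ₗ[K] V →ₛₗ[(conj : K →+* K)] K}

theorem localForm_one_tmul_one_tmul (v w : V) :
    localForm h p (1 ⊗ₜ[K] v) (1 ⊗ₜ[K] w) = algebraMap K (LocalAlg K p) (h v w) := by
  rw [localForm, extendForm_tmul, map_one, one_mul, one_mul]

theorem localForm_one_tmul_left (hh : IsHermitian h) (x : V) (w : LocalSpace K p V) :
    localForm h p (1 ⊗ₜ[K] x) w = localConj p conj (localForm h p w (1 ⊗ₜ[K] x)) := by
  induction w using TensorProduct.induction_on with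
  | zero => simp
  | add v w hv hw => simp only [map_add, LinearMap.add_apply, hv, hw]
  | tmul a v =>
    simp only [localForm, extendForm_tmul, map_one, mul_one, one_mul, map_mul,
      localConj_algebraMap]
    rw [hh x v]

theorem isUnit_det_gram_localForm {ι : Type*} [Fintype ι] [DecidableEq ι]
    (hh : h.SeparatingLeft) (b : Basis ι K V) :
    IsUnit (gram (localForm h p) (Algebra.TensorProduct.basis (LocalAlg K p) b)).det := by
  have hgram : gram (localForm h p) (Algebra.TensorProduct.basis (LocalAlg K p) b) =
      (algebraMap K (LocalAlg K p)).mapMatrix (gram h b) := by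
    ext i j
    simp [gram, localForm_one_tmul_one_tmul]
  rw [hgram, ← RingHom.map_det]
  exact (isUnit_det_gram hh b).map _

theorem baseChange_mem_unitaryGroup {σ : V ≃ₗ[K] V} (hσ : σ ∈ unitaryGroup h) :
    σ.baseChange K (LocalAlg K p) V V ∈ unitaryGroup (localForm h p) := by
  intro x y
  induction x using TensorProduct.induction_on with
  | zero => simp
  | add x x' hx hx' => simp only [map_add, LinearMap.add_apply, hx, hx']
  | tmul a v =>
    induction y using TensorProduct.induction_on with
    | zero => simp
    | add y y' hy hy' => simp only [map_add, hy, hy']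
    | tmul b w =>
      rw [LinearEquiv.baseChange_tmul, LinearEquiv.baseChange_tmul, localForm, extendForm_tmul,
        extendForm_tmul, hσ]

theorem inv_det_mul_mul_localConj [FiniteDimensional K V] (hh : h.SeparatingLeft)
    {σ : LocalSpace K p V ≃ₗ[LocalAlg K p] LocalSpace K p V}
    (hσ : σ ∈ unitaryGroup (localForm h p)) {d : Kˣ} {u : (LocalAlg K p)ˣ}
    (hu : u = (LinearEquiv.det σ)⁻¹ *
      Units.map (algebraMap K (LocalAlg K p) : K →* LocalAlg K p) d) :
    (u : LocalAlg K p) * localConj p conj u = algebraMap K (LocalAlg K p) (d * conj d) := by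
  have hdet := det_mul_map_det_eq_one
    (isUnit_det_gram_localForm (p := p) hh (finBasis K V)) (inv_mem hσ)
  rw [map_inv] at hdet
  have hd : localConj p conj (algebraMap K (LocalAlg K p) d) =
      algebraMap K (LocalAlg K p) (conj d) := localConj_algebraMap p conj d
  rw [hu, Units.val_mul, map_mul, mul_mul_mul_comm, hdet, one_mul, map_mul]
  exact congrArg _ hd

variable [Module (𝓞 K) V]

theorem localLattice_image {L N : Submodule (𝓞 K) V} {σ : V ≃ₗ[K] V}
    (hN : (N : Set V) = σ '' (L : Set V)) :
    (localLattice N p : Set (LocalSpace K p V)) =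
      σ.baseChange K (LocalAlg K p) V V '' (localLattice L p : Set _) := by
  have hmap : localLattice N p = (localLattice L p).map
      ((σ.baseChange K (LocalAlg K p) V V : LocalSpace K p V →ₗ[LocalAlg K p]
        LocalSpace K p V).restrictScalars (localInt K p)) := by
    rw [localLattice, localLattice, Submodule.map_span, hN, Set.image_image, Set.image_image]
    congr 1
  rw [hmap]
  rfl

variable [IsScalarTower (𝓞 K) K V] {L : Submodule (𝓞 K) V} {x : V}

theorem localForm_mem_localInt (hL : IsUnimodular h L) (hx : x ∈ L) {v : LocalSpace K p V}
    (hv : v ∈ localLattice L p) : localForm h p v (1 ⊗ₜ[K] x) ∈ localInt K p := by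
  induction hv using Submodule.span_induction with
  | zero => rw [map_zero, LinearMap.zero_apply]; exact zero_mem _
  | add v w _ _ hv hw => rw [map_add, LinearMap.add_apply]; exact add_mem hv hw
  | smul c v _ hv =>
    rw [Subalgebra.smul_def, map_smul, LinearMap.smul_apply, smul_eq_mul]
    exact mul_mem c.2 hv
  | mem v hv =>
    obtain ⟨y, hy, rfl⟩ := hv
    obtain ⟨r, hr⟩ := exists_eq_form hL hy hx
    rw [localForm_one_tmul_one_tmul, ← hr]
    exact algebraMap_mem_localInt r

theorem exists_mem_unitaryGroup_localForm_det_eq [FiniteDimensional K V] (hh : IsHermitian h)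
    (hL : IsUnimodular h L) (hx : x ∈ L) {m : ℤ} (hm : (m : K) = h x x) (hpm : ¬ (p : ℤ) ∣ m)
    {u : (LocalAlg K p)ˣ} (hu : u ∈ localUnits K p)
    (hnorm : (u : LocalAlg K p) * localConj p conj u = 1) :
    ∃ ρ ∈ unitaryGroup (localForm h p), LinearEquiv.det ρ = u ∧
      (localLattice L p : Set (LocalSpace K p V)) = ρ '' (localLattice L p : Set _) := by
  have hm₀ : (m : K) ≠ 0 := by
    intro hm₀
    exact hpm (Int.cast_eq_zero.mp hm₀ ▸ dvd_zero _)
  have hc : algebraMap K (LocalAlg K p) (m : K)⁻¹ *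
      localForm h p (1 ⊗ₜ[K] x) (1 ⊗ₜ[K] x) = 1 := by
    rw [localForm_one_tmul_one_tmul, ← hm, ← map_mul, inv_mul_cancel₀ hm₀, map_one]
  have hmem : ∀ e ∈ localInt K p, ∀ v ∈ localLattice L p,
      v + ((e - 1) * algebraMap K (LocalAlg K p) (m : K)⁻¹ * localForm h p v (1 ⊗ₜ[K] x)) •
        ((1 : LocalAlg K p) ⊗ₜ[K] x) ∈ localLattice L p := fun e he v hv =>
    Submodule.add_mem _ hv <| Submodule.smul_mem _
      (⟨_, mul_mem (mul_mem (sub_mem he (one_mem _)) (inv_intCast_mem_localInt hpm))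
        (localForm_mem_localInt hL hx hv)⟩ : localInt K p) <|
      Submodule.subset_span ⟨x, hx, rfl⟩
  refine ⟨quasiReflection (localForm h p) hc u,
    quasiReflection_mem_unitaryGroup (localForm_one_tmul_left hh x) hc hnorm,
    det_quasiReflection hc, ?_⟩
  ext v
  refine ⟨fun hv => ⟨(quasiReflection (localForm h p) hc u).symm v, ?_,
    LinearEquiv.apply_symm_apply _ v⟩, ?_⟩
  · rw [quasiReflection_symm_apply]
    exact hmem _ hu.2 v hv
  · rintro ⟨v, hv, rfl⟩
    rw [quasiReflection_apply]
    exact hmem _ hu.1 v hv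

end LocalUnitary

section Global

variable {K : Type*} [Field K] [NumberField K] {conj : K ≃ₐ[ℚ] K}
  {V : Type*} [AddCommGroup V] [Module K V] [Module (𝓞 K) V]
  [IsScalarTower (𝓞 K) K V] {h : V →ₗ[K] V →ₛₗ[(conj : K →+* K)] K} {L N N' : Submodule (𝓞 K) V}

theorem mem_specialGenus_symm (hL : L.IsLattice K) (hN : N ∈ specialGenus h L) :
    L ∈ specialGenus h N := by
  refine ⟨hL, fun p _ => ?_⟩
  obtain ⟨σ, hσ, hNσ⟩ := hN.2 p
  exact ⟨σ⁻¹, inv_mem hσ, ((σ.toEquiv.eq_image_iff_symm_image_eq _ _).mp hNσ).symm⟩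

theorem specialGenus_subset_genus : specialGenus h L ⊆ genus h L := fun _ hN =>
  ⟨hN.1, fun p _ => (hN.2 p).imp fun _ => And.imp_left And.left⟩

variable [FiniteDimensional K V] {b : Basis (Fin (finrank K V)) K V}

theorem detIdeal_le_of_mem_specialGenus (hL : L.IsLattice K) (hN : N ∈ specialGenus h L) :
    detIdeal b N ≤ detIdeal b L := by
  intro y hy
  obtain ⟨I, hI, -⟩ := exists_eq_detIdeal hL b
  rw [hI]
  refine mem_of_forall_mem_localIdeal I fun p _ => ?_
  obtain ⟨σ, ⟨-, hdet : LinearEquiv.det σ = 1⟩, hNσ⟩ := hN.2 p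
  have := inv_det_mul_mem_localIdeal b hNσ hy
  rwa [hdet, inv_one, Units.val_one, one_mul, hI] at this

theorem detIdeal_eq_of_mem_specialGenus (hL : L.IsLattice K) (hN : N ∈ specialGenus h L) :
    detIdeal b N = detIdeal b L :=
  (detIdeal_le_of_mem_specialGenus hL hN).antisymm
    (detIdeal_le_of_mem_specialGenus hN.1 (mem_specialGenus_symm hL hN))

theorem specialGenus_subset_partialGenus (hL : L.IsLattice K) :
    specialGenus h L ⊆ partialGenus h L (steinitzClass L) := fun N hN =>
  ⟨specialGenus_subset_genus hN,
    (steinitzClass_eq_iff_exists_detIdeal_eq_smul hL hN.1 (finBasis K V)).mpr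
      ⟨1, by rw [Units.val_one, one_smul, detIdeal_eq_of_mem_specialGenus hL hN]⟩⟩

-- At every prime `d` differs from the determinant of a local isometry, which has norm `1`, by a
-- local unit; so the norm of `d` is a positive global unit.
theorem mul_conj_eq_one_of_mem_genus [Algebra.IsQuadraticExtension ℚ K] [IsTotallyComplex K]
    (hconj : conj ≠ 1) (hh : h.SeparatingLeft) (hL : L.IsLattice K) (hN : N ∈ genus h L) {d : Kˣ}
    (hd : detIdeal b N = (d : K) • detIdeal b L) : (d : K) * conj d = 1 := by
  let e : Kˣ := d * Units.map (conj : K →* K) d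
  suffices he : ∃ u : (𝓞 K)ˣ, ((u : 𝓞 K) : K) = e from
    he.elim fun u hu => mul_conj_eq_one_of_eq_unit hconj hu
  refine exists_unit_eq_of_forall_mem_localUnits fun p _ => ?_
  obtain ⟨σ, hσ, hNσ⟩ := hN.2 p
  have hu := inv_det_mul_mem_localUnits hL hN.1 b hNσ hd
  convert mul_mem hu (map_localConj_mem_localUnits (conj := conj) hu) using 1
  ext
  exact (inv_det_mul_mul_localConj hh hσ rfl).symm

theorem exists_mem_unitaryGroup_det_eq [Algebra.IsQuadraticExtension ℚ K] (hconj : conj ≠ 1)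
    (hh : IsHermitian h) (hn : Odd (finrank K V)) (hL : IsUnimodular h L) {e : Kˣ}
    (he : (e : K) * conj e = 1) : ∃ σ ∈ unitaryGroup h, LinearEquiv.det σ = e := by
  obtain ⟨v, -, k, hk, hk₂⟩ := exists_norm_not_dvd hconj hh hn hL two_ne_zero
    (Nat.prime_iff_prime_int.mp Nat.prime_two).not_isUnit
  have hv : h v v ≠ 0 := by
    rintro hv
    rw [hv, Int.cast_eq_zero] at hk
    exact hk₂ (hk ▸ dvd_zero 2)
  exact ⟨quasiReflection h (inv_mul_cancel₀ hv) e,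
    quasiReflection_mem_unitaryGroup (hh v) (inv_mul_cancel₀ hv) he,
    det_quasiReflection (inv_mul_cancel₀ hv)⟩

theorem exists_mem_localUnitary_det_eq [Algebra.IsQuadraticExtension ℚ K] (hconj : conj ≠ 1)
    (hh : IsHermitian h) (hn : Odd (finrank K V)) (hL : IsUnimodular h L) {p : ℕ}
    [hp : Fact p.Prime] {u : (LocalAlg K p)ˣ} (hu : u ∈ localUnits K p)
    (hnorm : (u : LocalAlg K p) * localConj p conj u = 1) :
    ∃ ρ ∈ unitaryGroup (localForm h p), LinearEquiv.det ρ = u ∧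
      (localLattice L p : Set (LocalSpace K p V)) = ρ '' (localLattice L p : Set _) := by
  have hp' := Nat.prime_iff_prime_int.mp hp.out
  obtain ⟨v, hv, k, hk, hpk⟩ := exists_norm_not_dvd hconj hh hn hL hp'.ne_zero hp'.not_isUnit
  exact exists_mem_unitaryGroup_localForm_det_eq hh hL hv hk hpk hu hnorm

theorem exists_mem_specialGenus_mem_cls [Algebra.IsQuadraticExtension ℚ K] [IsTotallyComplex K]
    (hconj : conj ≠ 1) (hh : IsHermitian h) (hn : Odd (finrank K V)) (hL : IsUnimodular h L)
    (hN : N ∈ partialGenus h L (steinitzClass L)) : ∃ N' ∈ specialGenus h L, N' ∈ cls h N := by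
  obtain ⟨hNg, hNst⟩ := hN
  let b := finBasis K V
  obtain ⟨d, hd⟩ := (steinitzClass_eq_iff_exists_detIdeal_eq_smul hL.1 hNg.1 b).mp hNst
  have hsep := separatingLeft_of_isUnimodular hL
  have hdnorm := mul_conj_eq_one_of_mem_genus hconj hsep hL.1 hNg hd
  obtain ⟨σ, hσ, hσdet⟩ := exists_mem_unitaryGroup_det_eq hconj hh hn hL (e := d⁻¹) <| by
    rw [Units.val_inv_eq_inv_val, map_inv₀, ← mul_inv, hdnorm, inv_one]
  refine ⟨N.map ((σ : V →ₗ[K] V).restrictScalars (𝓞 K)), ⟨isLattice_map hNg.1 σ, fun p _ => ?_⟩,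
    σ, hσ, rfl⟩
  obtain ⟨ρ, hρ, hNρ⟩ := hNg.2 p
  obtain ⟨π, hπ, hπdet, hπL⟩ := exists_mem_localUnitary_det_eq hconj hh hn hL
    (inv_det_mul_mem_localUnits hL.1 hNg.1 b hNρ hd)
    ((inv_det_mul_mul_localConj hsep hρ rfl).trans (by rw [hdnorm, map_one]))
  refine ⟨σ.baseChange K (LocalAlg K p) V V * ρ * π,
    ⟨mul_mem (mul_mem (baseChange_mem_unitaryGroup hσ) hρ) hπ, MonoidHom.mem_ker.mpr ?_⟩, ?_⟩
  · rw [map_mul, map_mul, hπdet, LinearEquiv.det_baseChange, hσdet, map_inv]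
    exact (mul_assoc _ _ _).trans (by rw [mul_inv_cancel_left]; exact inv_mul_cancel _)
  · rw [localLattice_image (σ := σ) (L := N) rfl, hNρ]
    nth_rewrite 1 [hπL]
    rw [Set.image_image, Set.image_image]
    rfl

theorem exists_unit_eq_det_of_mem_specialGenus (hL : L.IsLattice K) (hN : N ∈ specialGenus h L)
    (hN' : N' ∈ specialGenus h L) {σ : V ≃ₗ[K] V} (hσ : (N' : Set V) = σ '' (N : Set V)) :
    ∃ u : (𝓞 K)ˣ, ((u : 𝓞 K) : K) = ((LinearEquiv.det σ)⁻¹ : Kˣ) := by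
  refine exists_unit_eq_of_forall_mem_localUnits fun p _ => ?_
  have hdet : detIdeal (finBasis K V) N' = ((1 : Kˣ) : K) • detIdeal (finBasis K V) N := by
    rw [Units.val_one, one_smul, detIdeal_eq_of_mem_specialGenus hL hN',
      detIdeal_eq_of_mem_specialGenus hL hN]
  have := inv_det_mul_mem_localUnits hN.1 hN'.1 _ (localLattice_image (p := p) hσ) hdet
  rwa [LinearEquiv.det_baseChange, map_one, mul_one, ← map_inv] at this

-- Multiplication by an `n`-th root of the unit `(det σ)⁻¹` corrects the determinant of `σ`
-- without changing any lattice.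
theorem mem_specialCls_of_mem_cls [Algebra.IsQuadraticExtension ℚ K] [IsTotallyComplex K]
    (hconj : conj ≠ 1) (hn : (finrank K V).Coprime (Units.torsionOrder K)) (hL : L.IsLattice K)
    (hN : N ∈ specialGenus h L) (hN' : N' ∈ specialGenus h L) (hcls : N' ∈ cls h N) :
    N' ∈ specialCls h N := by
  obtain ⟨σ, hσ, hNσ⟩ := hcls
  obtain ⟨u, hu⟩ := exists_unit_eq_det_of_mem_specialGenus hL hN hN' hNσ
  obtain ⟨ζ, rfl⟩ := exists_unit_pow_eq hn u
  let s : Kˣ := Units.map (algebraMap (𝓞 K) K : 𝓞 K →* K) ζ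
  have hs : s ^ finrank K V = (LinearEquiv.det σ)⁻¹ := Units.ext <| by
    simpa [s] using hu
  refine ⟨σ * LinearEquiv.smulOfUnit s, ⟨mul_mem hσ
    (smulOfUnit_mem_unitaryGroup (unit_mul_conj_eq_one hconj ζ)), MonoidHom.mem_ker.mpr ?_⟩, ?_⟩
  · rw [map_mul, det_smulOfUnit, hs, mul_inv_cancel]
  · rw [hNσ, coe_eq_smulOfUnit_image ζ N, Set.image_image]
    simp only [← coe_eq_smulOfUnit_image ζ N]
    rfl

end Global

end HermLat

end

theorem corollary1_general {K : Type*} [Field K] [NumberField K]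
    (hK : Module.finrank ℚ K = 2) [NumberField.IsTotallyComplex K]
    (conj : K ≃ₐ[ℚ] K) (hconj : conj ≠ AlgEquiv.refl)
    {V : Type*} [AddCommGroup V] [Module K V] [FiniteDimensional K V]
    [Module (NumberField.RingOfIntegers K) V] [IsScalarTower (NumberField.RingOfIntegers K) K V]
    (h : V →ₗ[K] V →ₛₗ[(conj : K →+* K)] K) (hh : HermLat.IsHermitian h)
    (hn : (Module.finrank K V).Coprime (NumberField.Units.torsionOrder K))
    (L : Submodule (NumberField.RingOfIntegers K) V) (hL : HermLat.IsUnimodular h L) :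
    HermLat.specialClassNumber h L =
      HermLat.partialClassNumber h L (HermLat.steinitzClass L) := by
  have : Algebra.IsQuadraticExtension ℚ K := ⟨hK⟩
  have hodd : Odd (Module.finrank K V) :=
    Nat.coprime_two_right.mp (hn.coprime_dvd_right (Units.even_torsionOrder K).two_dvd)
  refine HermLat.mk_image_eq_mk_image (HermLat.specialGenus_subset_partialGenus hL.1)
    (fun N hN => ?_) (fun N hN N' hN' => ?_)
  · obtain ⟨N', hN', hcls⟩ := HermLat.exists_mem_specialGenus_mem_cls hconj hh hodd hL hN
    exact ⟨N', hN', HermLat.cls_eq_cls_iff.mpr hcls⟩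
  · rw [HermLat.specialCls_eq_specialCls_iff, HermLat.cls_eq_cls_iff]
    exact ⟨fun ⟨σ, hσ, hNσ⟩ => ⟨σ, hσ.1, hNσ⟩,
      HermLat.mem_specialCls_of_mem_cls hconj hn hL.1 hN' hN⟩

theorem corollary1 {K : Type*} [Field K] [NumberField K]
    (hK : Module.finrank ℚ K = 2) [NumberField.IsTotallyComplex K]
    (hd₃ : NumberField.discr K ≠ -3) (hd₄ : NumberField.discr K ≠ -4)
    (conj : K ≃ₐ[ℚ] K) (hconj : conj ≠ AlgEquiv.refl)
    {V : Type*} [AddCommGroup V] [Module K V] [FiniteDimensional K V]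
    [Module (NumberField.RingOfIntegers K) V] [IsScalarTower (NumberField.RingOfIntegers K) K V]
    (h : V →ₗ[K] V →ₛₗ[(conj : K →+* K)] K) (hh : HermLat.IsHermitian h)
    (hn : Odd (Module.finrank K V))
    (L : Submodule (NumberField.RingOfIntegers K) V) (hL : HermLat.IsUnimodular h L) :
    HermLat.specialClassNumber h L =
      HermLat.partialClassNumber h L (HermLat.steinitzClass L) := by
  have : Algebra.IsQuadraticExtension ℚ K := ⟨hK⟩
  exact corollary1_general hK conj hconj h hh
    (HermLat.torsionOrder_eq_two hd₃ hd₄ ▸ hn.coprime_two_right) L hL
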